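/- Setting. Let $N_B\ge 0$, $0<\eta<1$, $M\in\mathbb N$. Let $\rho_{\rm th}(N)=\sum_{n\ge0}\frac{N^n}{(N+1)^{n+1}}|n\rangle\langle n|$ be the single-mode thermal state of mean photon number $N$. For $0\le\kappa\le1$ let $\mathcal L_{\kappa,N}$ be the thermal loss channel: the input mode $a$ is mixed with a background mode $b$ in state $\rho_{\rm th}(N)$ on a beam splitter with output modes $\sqrt\kappa\,a+\sqrt{1-\kappa}\,b$ and $\sqrt{1-\kappa}\,a-\sqrt\kappa\,b$, and the second output mode is traced out. A probe with $M$ signal modes $S$ and an idler $I$ (an arbitrary complex Hilbert space) is $\Psi=|\psi\rangle\langle\psi|$ with $|\psi\rangle=\sum_{\mathbf n\in\mathbb N^M}\sqrt{p_{\mathbf n}}\,|\chi_{\mathbf n}\rangle_I|\mathbf n\rangle_S$, where $(p_{\mathbf n})$ is a probability distribution and the $\chi_{\mathbf n}$ are unit vectors, not necessarily orthogonal. Define $$\rho_0=(\mathrm{Tr}_S\Psi)\otimes\rho_{\rm th}(N_B)^{\otimes M},\quad \rho_1=(\mathrm{id}_I\otimes\mathcal L_{\eta,N_B}^{\otimes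 M})\Psi,\quad \sigma_0=\rho_{\rm th}(N_B)^{\otimes M},\quad \sigma_1=\mathcal L_{1-\eta,N_B}^{\otimes M}(\mathrm{Tr}_I\Psi),$$ $$P_e^A=\tfrac12-\tfrac14\|\rho_0-\rho_1\|_1,\qquad P_e^W=\tfrac12-\tfrac14\|\sigma_0-\sigma_1\|_1,\qquad \|X\|_1=\mathrm{Tr}\sqrt{X^\dagger X}.$$ For $0\le\epsilon\le\frac12$ the probe is $\epsilon$-covert if $P_e^W\ge\frac12-\epsilon$. Put $$\Theta=\frac{\sqrt{(1-\eta)(N_B+1)}}{\sqrt{1+(1-\eta)N_B}},\qquad x=1-\frac{1-\Theta}{1-\eta[1+N_B(1-\Theta)]},$$ $$\nu=\Big(\sqrt{G_0G_1}-\sqrt{(G_0-1)(G_1-1)}\Big)^{-1},\quad G_0=N_B+1,\ G_1=(1-\eta)N_B+1,$$ $$f_{\eta,N_B}=\nu\Big(N_B+1-\frac{N_B}{x}\Big)\big[\eta N_B(1-x)+1\big]$$ (with $N_B/x$ read as $0$ if $N_B=0$). The convergence condition is: $1-\eta[1+N_B(1-\Theta)]\neq0$ and $\frac{N_B}{N_B+1}\le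 x\le1$. Statement. (i) If $\eta\le 0.4$, the convergence condition holds for every $N_B\ge0$. (ii) Whenever the convergence condition holds, every $\epsilon$-covert probe with $M$ signal modes satisfies $$P_e^A\ \ge\ \frac{1-\sqrt{1-(1-2\epsilon)^4 f_{\eta,N_B}^{2M}}}{2}.$$ -/

import Mathlib

open scoped ENNReal InnerProductSpace

noncomputable section

namespace CovertQI

/-! ### Beam splitter -/

/-- The Fischer (Fock) pairing on two-mode polynomials, `⟨x^d, x^e⟩ = δ_{de} ∏ dᵢ!`. -/
def fischer (f g : MvPolynomial (Fin 2) ℝ) : ℝ :=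
  ∑ d ∈ f.support, ((d 0).factorial * (d 1).factorial : ℝ) * f.coeff d * g.coeff d

lemma fischer_eq_of_subset {f : MvPolynomial (Fin 2) ℝ} (g : MvPolynomial (Fin 2) ℝ)
    {s : Finset (Fin 2 →₀ ℕ)} (hs : f.support ⊆ s) :
    fischer f g = ∑ d ∈ s, ((d 0).factorial * (d 1).factorial : ℝ) * f.coeff d * g.coeff d := by
  refine Finset.sum_subset hs fun d _ hd => ?_
  rw [MvPolynomial.notMem_support_iff.mp hd]; ring

lemma fischer_comm (f g : MvPolynomial (Fin 2) ℝ) : fischer f g = fischer g f := by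
  classical
  rw [fischer_eq_of_subset g (Finset.subset_union_left (s₂ := g.support)),
    fischer_eq_of_subset f (Finset.subset_union_right (s₁ := f.support))]
  exact Finset.sum_congr rfl fun d _ => by ring

lemma fischer_add_left (f f' g : MvPolynomial (Fin 2) ℝ) :
    fischer (f + f') g = fischer f g + fischer f' g := by
  classical
  rw [fischer_eq_of_subset g (MvPolynomial.support_add (p := f) (q := f')),
    fischer_eq_of_subset g (Finset.subset_union_left (s₂ := f'.support)),
    fischer_eq_of_subset g (Finset.subset_union_right (s₁ := f.support)),
    ← Finset.sum_add_distrib]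
  exact Finset.sum_congr rfl fun d _ => by rw [MvPolynomial.coeff_add]; ring

lemma fischer_add_right (f g g' : MvPolynomial (Fin 2) ℝ) :
    fischer f (g + g') = fischer f g + fischer f g' := by
  rw [fischer_comm, fischer_add_left, fischer_comm g, fischer_comm g']

lemma fischer_smul_left (c : ℝ) (f g : MvPolynomial (Fin 2) ℝ) :
    fischer (MvPolynomial.C c * f) g = c * fischer f g := by
  classical
  have hs : (MvPolynomial.C c * f).support ⊆ f.support := fun d hd => by
    rw [MvPolynomial.mem_support_iff, MvPolynomial.coeff_C_mul] at hd
    exact MvPolynomial.mem_support_iff.mpr (right_ne_zero_of_mul hd)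
  rw [fischer_eq_of_subset g hs, fischer, Finset.mul_sum]
  exact Finset.sum_congr rfl fun d _ => by rw [MvPolynomial.coeff_C_mul]; ring

lemma fischer_smul_right (c : ℝ) (f g : MvPolynomial (Fin 2) ℝ) :
    fischer f (MvPolynomial.C c * g) = c * fischer f g := by
  rw [fischer_comm, fischer_smul_left, fischer_comm]

lemma fischer_monomial (d : Fin 2 →₀ ℕ) (a : ℝ) (g : MvPolynomial (Fin 2) ℝ) :
    fischer (MvPolynomial.monomial d a) g =
      ((d 0).factorial * (d 1).factorial : ℝ) * a * g.coeff d := by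
  classical
  rw [fischer_eq_of_subset g MvPolynomial.support_monomial_subset]
  simp

lemma fischer_X_mul (i : Fin 2) (f g : MvPolynomial (Fin 2) ℝ) :
    fischer (MvPolynomial.X i * f) g = fischer f (MvPolynomial.pderiv i g) := by
  induction f using MvPolynomial.induction_on' with
  | monomial d a =>
    rw [mul_comm, MvPolynomial.X, MvPolynomial.monomial_mul, mul_one, fischer_monomial,
      fischer_monomial, MvPolynomial.coeff_pderiv]
    fin_cases i <;> simp [Nat.factorial_succ] <;> ring
  | add p q hp hq => rw [mul_add, fischer_add_left, fischer_add_left, hp, hq]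

/-- The two-mode polynomial `(√κ x + √(1-κ) y)ⁿ (√(1-κ) x - √κ y)ᵐ`. With `x`, `y` read as the
creation operators of the two output modes, applying it to the two-mode vacuum gives
`√(n! m!) U|n, m⟩`, where `U` is the beam splitter of transmittance `κ`, i.e.
`U† a U = √κ a + √(1-κ) b` and `U† b U = √(1-κ) a - √κ b`. -/
def bsPoly (κ : unitInterval) (n m : ℕ) : MvPolynomial (Fin 2) ℝ :=
  (MvPolynomial.C (√(κ : ℝ)) * MvPolynomial.X 0
      + MvPolynomial.C (√(1 - (κ : ℝ))) * MvPolynomial.X 1) ^ n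
    * (MvPolynomial.C (√(1 - (κ : ℝ))) * MvPolynomial.X 0
      - MvPolynomial.C (√(κ : ℝ)) * MvPolynomial.X 1) ^ m

/-- The number-basis amplitude `⟨j, k|U|n, m⟩` of the beam splitter of transmittance `κ`; the
first entry of each pair is the signal (resp. transmitted) mode, the second the background
(resp. environment) mode. -/
def bsAmp (κ : unitInterval) (n m j k : ℕ) : ℝ :=
  √((j.factorial * k.factorial : ℝ) / (n.factorial * m.factorial)) *
    (bsPoly κ n m).coeff (Finsupp.single 0 j + Finsupp.single 1 k)

lemma fischer_bsPoly (κ : unitInterval) (n m : ℕ) :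
    fischer (bsPoly κ n m) (bsPoly κ n m) = n.factorial * m.factorial := by
  have ht : √(κ : ℝ) * √(κ : ℝ) = κ := Real.mul_self_sqrt κ.2.1
  have hr : √(1 - (κ : ℝ)) * √(1 - (κ : ℝ)) = 1 - κ :=
    Real.mul_self_sqrt (sub_nonneg.mpr κ.2.2)
  set t := √(κ : ℝ)
  set r := √(1 - (κ : ℝ))
  set P : MvPolynomial (Fin 2) ℝ :=
    MvPolynomial.C t * MvPolynomial.X 0 + MvPolynomial.C r * MvPolynomial.X 1 with hP
  set Q : MvPolynomial (Fin 2) ℝ :=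
    MvPolynomial.C r * MvPolynomial.X 0 - MvPolynomial.C t * MvPolynomial.X 1 with hQ
  have hb : ∀ n m, bsPoly κ n m = P ^ n * Q ^ m := fun _ _ => rfl
  have hPP : MvPolynomial.C t * MvPolynomial.C t + MvPolynomial.C r * MvPolynomial.C r
      = (1 : MvPolynomial (Fin 2) ℝ) := by
    rw [← MvPolynomial.C_mul, ← MvPolynomial.C_mul, ← MvPolynomial.C_add, ht, hr]; simp
  have h0P : MvPolynomial.pderiv 0 P = MvPolynomial.C t := by
    simp [hP]
  have h1P : MvPolynomial.pderiv 1 P = MvPolynomial.C r := by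
    simp [hP]
  have h0Q : MvPolynomial.pderiv 0 Q = MvPolynomial.C r := by
    simp [hQ]
  have h1Q : MvPolynomial.pderiv 1 Q = -MvPolynomial.C t := by
    simp [hQ]
  have adjP : ∀ f g, fischer (P * f) g = fischer f
      (MvPolynomial.C t * MvPolynomial.pderiv 0 g + MvPolynomial.C r * MvPolynomial.pderiv 1 g) := by
    intro f g
    rw [hP, add_mul, fischer_add_left, mul_assoc, mul_assoc, fischer_smul_left, fischer_smul_left,
      fischer_X_mul, fischer_X_mul, fischer_add_right, fischer_smul_right, fischer_smul_right]
  have adjQ : ∀ f g, fischer (Q * f) g = fischer f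
      (MvPolynomial.C r * MvPolynomial.pderiv 0 g
        + MvPolynomial.C (-t) * MvPolynomial.pderiv 1 g) := by
    intro f g
    have : Q = MvPolynomial.C r * MvPolynomial.X 0 + MvPolynomial.C (-t) * MvPolynomial.X 1 := by
      rw [hQ, MvPolynomial.C_neg]; ring
    rw [this, add_mul, fischer_add_left, mul_assoc, mul_assoc, fischer_smul_left,
      fischer_smul_left, fischer_X_mul, fischer_X_mul, fischer_add_right, fischer_smul_right,
      fischer_smul_right]
  induction n with
  | succ n ih =>
    have e : bsPoly κ (n + 1) m = P * bsPoly κ n m := by rw [hb, hb]; ring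
    rw [e, adjP]
    have d : MvPolynomial.C t * MvPolynomial.pderiv 0 (P * bsPoly κ n m)
        + MvPolynomial.C r * MvPolynomial.pderiv 1 (P * bsPoly κ n m)
        = MvPolynomial.C ((n : ℝ) + 1) * bsPoly κ n m := by
      have hn : P * P ^ (n - 1) * (n : MvPolynomial (Fin 2) ℝ) = n * P ^ n := by
        cases n with
        | zero => simp
        | succ k => simp; ring
      rw [hb]
      simp only [Derivation.leibniz, Derivation.leibniz_pow, smul_eq_mul, nsmul_eq_mul,
        h0P, h1P, h0Q, h1Q, map_add, MvPolynomial.C_1, map_natCast]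
      linear_combination (P ^ n * Q ^ m) * hPP
        + (P * P ^ (n - 1) * (n : MvPolynomial (Fin 2) ℝ) * Q ^ m) * hPP + Q ^ m * hn
    rw [d, fischer_smul_right, ih, Nat.factorial_succ]
    push_cast; ring
  | zero =>
    induction m with
    | succ m ih =>
      have e : bsPoly κ 0 (m + 1) = Q * bsPoly κ 0 m := by rw [hb, hb]; ring
      rw [e, adjQ]
      have d : MvPolynomial.C r * MvPolynomial.pderiv 0 (Q * bsPoly κ 0 m)
          + MvPolynomial.C (-t) * MvPolynomial.pderiv 1 (Q * bsPoly κ 0 m)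
          = MvPolynomial.C ((m : ℝ) + 1) * bsPoly κ 0 m := by
        have hn : Q * Q ^ (m - 1) * (m : MvPolynomial (Fin 2) ℝ) = m * Q ^ m := by
          cases m with
          | zero => simp
          | succ k => simp; ring
        rw [hb]
        simp only [pow_zero, one_mul, Derivation.leibniz, Derivation.leibniz_pow, smul_eq_mul,
          nsmul_eq_mul, h0Q, h1Q, map_add, MvPolynomial.C_1, map_natCast, MvPolynomial.C_neg]
        linear_combination (Q ^ m) * hPP
          + (Q * Q ^ (m - 1) * (m : MvPolynomial (Fin 2) ℝ)) * hPP + hn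
      rw [d, fischer_smul_right, ih, Nat.factorial_succ]
      push_cast; ring
    | zero =>
      rw [hb]
      have : (P ^ 0 * Q ^ 0 : MvPolynomial (Fin 2) ℝ) = MvPolynomial.monomial 0 1 := by simp
      rw [this, fischer_monomial]
      simp

lemma abs_bsAmp_le_one (κ : unitInterval) (n m j k : ℕ) : |bsAmp κ n m j k| ≤ 1 := by
  classical
  set d : Fin 2 →₀ ℕ := Finsupp.single 0 j + Finsupp.single 1 k with hd
  have h0 : d 0 = j := by simp [hd]
  have h1 : d 1 = k := by simp [hd]
  have key : (j.factorial * k.factorial : ℝ) * (bsPoly κ n m).coeff d ^ 2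
      ≤ n.factorial * m.factorial := by
    rw [← fischer_bsPoly κ n m,
      fischer_eq_of_subset _ (Finset.subset_insert d (bsPoly κ n m).support)]
    have := Finset.single_le_sum
      (f := fun e : Fin 2 →₀ ℕ => ((e 0).factorial * (e 1).factorial : ℝ)
        * (bsPoly κ n m).coeff e * (bsPoly κ n m).coeff e)
      (fun e _ => by
        rw [mul_assoc]; exact mul_nonneg (by positivity) (mul_self_nonneg _))
      (Finset.mem_insert_self d (bsPoly κ n m).support)
    simp only [h0, h1] at this
    refine le_trans (le_of_eq ?_) this
    ring
  have hpos : (0 : ℝ) < n.factorial * m.factorial := by positivity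
  rw [← sq_le_one_iff_abs_le_one, bsAmp, mul_pow, Real.sq_sqrt (by positivity), div_mul_eq_mul_div,
    div_le_one hpos]
  exact key

/-! ### States and channels

The space of an `M`-mode bosonic system together with an auxiliary system `H` is `ℓ²(ℕᴹ; H)`, the
Hilbert tensor product of `H` with the `M`-mode Fock space; `ψ n` is the `H`-component of `ψ` along
the number state `|n⟩`. The `M`-mode Fock space itself is the case `H = ℂ`. -/

/-- `H ⊗ (M-mode Fock space)`, realised as `ℓ²(ℕᴹ; H)`. -/
abbrev Modes (M : ℕ) (H : Type*) [NormedAddCommGroup H] : Type _ :=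
  lp (fun _ : Fin M → ℕ => H) 2

variable {M : ℕ} {H : Type*} [NormedAddCommGroup H] [InnerProductSpace ℂ H]

/-- Amplitudes of `(1_H ⊗ ⟨k|U^{⊗M}|m⟩) ψ`: since `U` conserves the photon number of each pair of
modes, only `|j + k - m⟩` contributes to the component along `|j⟩`. -/
def krausFun (κ : unitInterval) (m k : Fin M → ℕ) (ψ : (Fin M → ℕ) → H) (j : Fin M → ℕ) : H :=
  open Classical in
  if m ≤ j + k then
    ((∏ i, bsAmp κ ((j + k - m) i) (m i) (j i) (k i) : ℝ) : ℂ) • ψ (j + k - m)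
  else 0

lemma sum_krausFun_le (κ : unitInterval) (m k : Fin M → ℕ) (ψ : Modes M H)
    (s : Finset (Fin M → ℕ)) :
    ∑ j ∈ s, ‖krausFun κ m k (ψ : (Fin M → ℕ) → H) j‖ ^ (2 : ℝ≥0∞).toReal
      ≤ ‖ψ‖ ^ (2 : ℝ≥0∞).toReal := by
  classical
  have h2 : 0 < (2 : ℝ≥0∞).toReal := by norm_num
  have hz : ∀ j ∈ s, j ∉ s.filter (fun j => m ≤ j + k) →
      ‖krausFun κ m k (ψ : (Fin M → ℕ) → H) j‖ ^ (2 : ℝ≥0∞).toReal = 0 := by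
    intro j hj hj'
    have : ¬ m ≤ j + k := fun h => hj' (Finset.mem_filter.mpr ⟨hj, h⟩)
    simp [krausFun, this]
  rw [← Finset.sum_subset (Finset.filter_subset (fun j => m ≤ j + k) s) hz]
  have hinj : Set.InjOn (fun j : Fin M → ℕ => j + k - m)
      (s.filter (fun j => m ≤ j + k) : Set (Fin M → ℕ)) := by
    intro a ha b hb hab
    have ha' := (Finset.mem_filter.mp (Finset.mem_coe.mp ha)).2
    have hb' := (Finset.mem_filter.mp (Finset.mem_coe.mp hb)).2
    funext i
    have h1 := ha' i
    have h2 := hb' i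
    have h3 := congrFun hab i
    simp only [Pi.add_apply, Pi.sub_apply] at h1 h2 h3
    omega
  calc ∑ j ∈ s.filter (fun j => m ≤ j + k),
        ‖krausFun κ m k (ψ : (Fin M → ℕ) → H) j‖ ^ (2 : ℝ≥0∞).toReal
      ≤ ∑ j ∈ s.filter (fun j => m ≤ j + k), ‖ψ (j + k - m)‖ ^ (2 : ℝ≥0∞).toReal := by
        refine Finset.sum_le_sum fun j hj => ?_
        have hj' := (Finset.mem_filter.mp hj).2
        refine Real.rpow_le_rpow (norm_nonneg _) ?_ h2.le
        rw [krausFun, if_pos hj', norm_smul, Complex.norm_real, Real.norm_eq_abs,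
          Finset.abs_prod]
        exact mul_le_of_le_one_left (norm_nonneg _)
          (Finset.prod_le_one (fun _ _ => abs_nonneg _) fun _ _ => abs_bsAmp_le_one ..)
    _ = ∑ n ∈ (s.filter (fun j => m ≤ j + k)).image (fun j => j + k - m),
          ‖ψ n‖ ^ (2 : ℝ≥0∞).toReal := by
        rw [Finset.sum_image hinj]
    _ ≤ ‖ψ‖ ^ (2 : ℝ≥0∞).toReal := lp.sum_rpow_le_norm_rpow h2 ψ _

/-- `1_H ⊗ ⟨k|U^{⊗M}|m⟩`, where `U` is the beam splitter of transmittance `κ` and `⟨k|`, `|m⟩` are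
number states of the background modes: the Kraus operators of the beam splitter for background
input `|m⟩`. -/
def kraus (κ : unitInterval) (m k : Fin M → ℕ) : Modes M H →L[ℂ] Modes M H :=
  LinearMap.mkContinuous
    { toFun := fun ψ => ⟨krausFun κ m k ψ, memℓp_gen' (sum_krausFun_le κ m k ψ)⟩
      map_add' := fun ψ φ => by
        ext j
        change krausFun κ m k (fun n => ψ n + φ n) j = krausFun κ m k ψ j + krausFun κ m k φ j
        by_cases h : m ≤ j + k <;> simp [krausFun, h, smul_add]
      map_smul' := fun c ψ => by
        ext j
        by_cases h : m ≤ j + k <;> simp [krausFun, h, smul_comm c] }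
    1 fun ψ => by
      rw [one_mul]
      exact lp.norm_le_of_forall_sum_le (by norm_num) (norm_nonneg _) (sum_krausFun_le κ m k ψ)

/-- Number distribution of `ρ_th(N)^{⊗M}`, the `M`-mode thermal state with `N` mean photons per
mode. -/
def thermalPMF (N : ℝ) (n : Fin M → ℕ) : ℝ :=
  ∏ i, N ^ n i / (N + 1) ^ (n i + 1)

variable [CompleteSpace H]

open ContinuousLinearMap in
/-- `id_H ⊗ L_{κ,N}^{⊗M}`, with `L_{κ,N}` the thermal loss channel: each mode is mixed, on a beam
splitter of transmittance `κ`, with a background mode in the thermal state of mean photon number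
`N`, and the second output mode of each beam splitter is traced out, i.e.
`X ↦ ∑_{m,k} p_th(m) K_{m,k} X K_{m,k}†`. The sum converges in norm on trace-class operators. -/
def thermalLoss (κ : unitInterval) (N : ℝ) (X : Modes M H →L[ℂ] Modes M H) :
    Modes M H →L[ℂ] Modes M H :=
  ∑' e : (Fin M → ℕ) × (Fin M → ℕ),
    ((thermalPMF N e.1 : ℝ) : ℂ) • (kraus κ e.1 e.2 ∘L X ∘L adjoint (kraus κ e.1 e.2))

/-- `X ⊗ ρ_th(N)^{⊗M} = ∑ₙ p_th(n) (X ⊗ |n⟩⟨n|)`. -/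
def tensorThermal (M : ℕ) (N : ℝ) (X : H →L[ℂ] H) : Modes M H →L[ℂ] Modes M H :=
  ∑' n : Fin M → ℕ, ((thermalPMF N n : ℝ) : ℂ) •
    (lp.singleContinuousLinearMap ℂ (fun _ : Fin M → ℕ => H) 2 n ∘L X
      ∘L lp.evalCLM ℂ (fun _ : Fin M → ℕ => H) 2 n)

/-- `ρ_th(N)^{⊗M}` on the `M`-mode Fock space. -/
def thermalState (M : ℕ) (N : ℝ) : Modes M ℂ →L[ℂ] Modes M ℂ :=
  tensorThermal M N (1 : ℂ →L[ℂ] ℂ)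

/-- Partial trace over the `M` bosonic modes, `X ↦ ∑ₙ ⟨n|X|n⟩`. -/
def traceModes (X : Modes M H →L[ℂ] Modes M H) : H →L[ℂ] H :=
  ∑' n : Fin M → ℕ, lp.evalCLM ℂ (fun _ : Fin M → ℕ => H) 2 n ∘L X
    ∘L lp.singleContinuousLinearMap ℂ (fun _ : Fin M → ℕ => H) 2 n

/-- An index set of an orthonormal (Hilbert) basis of `H`. -/
def basisSet (H : Type*) [NormedAddCommGroup H] [InnerProductSpace ℂ H] [CompleteSpace H] :
    Set H :=
  (exists_hilbertBasis ℂ H).choose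

/-- An orthonormal (Hilbert) basis of `H`. -/
def onb (H : Type*) [NormedAddCommGroup H] [InnerProductSpace ℂ H] [CompleteSpace H] :
    HilbertBasis (basisSet H) ℂ H :=
  (exists_hilbertBasis ℂ H).choose_spec.choose

/-- `⟨h| ⊗ 1 : H ⊗ (Fock space) → Fock space`. -/
def braH (h : H) : Modes M H →L[ℂ] Modes M ℂ :=
  lp.mapCLM 2 (fun _ : Fin M → ℕ => innerSL ℂ h) (norm_nonneg h)
    (fun _ => (innerSL_apply_norm (𝕜 := ℂ) h).le)

open ContinuousLinearMap in
/-- Partial trace over the auxiliary system, `X ↦ ∑_b ⟨b|X|b⟩` over an orthonormal basis of `H`. -/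
def traceAux (X : Modes M H →L[ℂ] Modes M H) : Modes M ℂ →L[ℂ] Modes M ℂ :=
  ∑' i : basisSet H, braH (onb H i) ∘L X ∘L adjoint (braH (onb H i))

/-! ### Trace norm and discrimination error -/

/-- The trace norm `‖X‖₁ = Tr √(X† X)`, as an extended nonnegative real. -/
def traceNorm (X : H →L[ℂ] H) : ℝ≥0∞ :=
  ∑' i : basisSet H, ENNReal.ofReal (RCLike.re ⟪onb H i, CFC.abs X (onb H i)⟫_ℂ)

/-- Least average error probability for discriminating two equally likely states,
`1/2 - ‖ρ₀ - ρ₁‖₁ / 4`. -/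
def errorProb (ρ₀ ρ₁ : H →L[ℂ] H) : ℝ :=
  1 / 2 - (traceNorm (ρ₀ - ρ₁)).toReal / 4

/-! ### Probes and the two hypothesis tests -/

/-- Data of a probe `∑ₙ √(pₙ) |χₙ⟩_I |n⟩_S` with `M` signal modes and idler space `I`: a
probability distribution `p` on `ℕᴹ` and unit vectors `χₙ` (not necessarily orthogonal). -/
structure Probe (M : ℕ) (I : Type*) [NormedAddCommGroup I] where
  p : (Fin M → ℕ) → ℝ
  χ : (Fin M → ℕ) → I
  p_nonneg : ∀ n, 0 ≤ p n
  p_sum : HasSum p 1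
  χ_norm : ∀ n, ‖χ n‖ = 1

namespace Probe

variable {I : Type*} [NormedAddCommGroup I] [InnerProductSpace ℂ I]

/-- The vector `∑ₙ √(pₙ) |χₙ⟩_I |n⟩_S`. -/
def ket (P : Probe M I) : Modes M I :=
  ⟨fun n => ((√(P.p n) : ℝ) : ℂ) • P.χ n, memℓp_gen (by
    refine P.p_sum.summable.congr fun n => ?_
    rw [norm_smul, P.χ_norm, mul_one, Complex.norm_real, Real.norm_eq_abs,
      abs_of_nonneg (Real.sqrt_nonneg _), ENNReal.toReal_ofNat, Real.rpow_ofNat,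
      Real.sq_sqrt (P.p_nonneg n)])⟩

/-- The density operator `Ψ = |ψ⟩⟨ψ|`. -/
def density (P : Probe M I) : Modes M I →L[ℂ] Modes M I :=
  InnerProductSpace.rankOne ℂ P.ket P.ket

variable [CompleteSpace I]

/-- Alice's state when the target is absent, `(Tr_S Ψ) ⊗ ρ_th(N_B)^{⊗M}`. -/
def aliceAbsent (P : Probe M I) (N_B : ℝ) : Modes M I →L[ℂ] Modes M I :=
  tensorThermal M N_B (traceModes P.density)

/-- Alice's state when the target is present, `(id_I ⊗ L_{η,N_B}^{⊗M}) Ψ`. -/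
def alicePresent (P : Probe M I) (η : unitInterval) (N_B : ℝ) : Modes M I →L[ℂ] Modes M I :=
  thermalLoss η N_B P.density

/-- Willie's state when Alice has sent the probe, `L_{1-η,N_B}^{⊗M} (Tr_I Ψ)`. -/
def willieProbed (P : Probe M I) (η : unitInterval) (N_B : ℝ) : Modes M ℂ →L[ℂ] Modes M ℂ :=
  thermalLoss (unitInterval.symm η) N_B (traceAux P.density)

/-- Alice's error probability `P_e^A`. -/
def aliceError (P : Probe M I) (η : unitInterval) (N_B : ℝ) : ℝ :=
  errorProb (P.aliceAbsent N_B) (P.alicePresent η N_B)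

/-- Willie's error probability `P_e^W`; his null-hypothesis state is `ρ_th(N_B)^{⊗M}`. -/
def willieError (P : Probe M I) (η : unitInterval) (N_B : ℝ) : ℝ :=
  errorProb (thermalState M N_B) (P.willieProbed η N_B)

/-- `ε`-covertness. -/
def IsCovert (P : Probe M I) (η : unitInterval) (N_B ε : ℝ) : Prop :=
  1 / 2 - ε ≤ P.willieError η N_B

end Probe

/-! ### The constants of the bound -/

/-- `Θ = √((1-η)(N_B+1)) / √(1+(1-η)N_B)`. -/
def Theta (η N_B : ℝ) : ℝ :=
  √((1 - η) * (N_B + 1)) / √(1 + (1 - η) * N_B)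

/-- `1 - η [1 + N_B (1 - Θ)]`, the denominator in `x`. -/
def xDenom (η N_B : ℝ) : ℝ :=
  1 - η * (1 + N_B * (1 - Theta η N_B))

/-- `x = 1 - (1 - Θ) / (1 - η [1 + N_B (1 - Θ)])`, the solution of
`1 + (x - 1)(1 - η) / (η N_B (1 - x) + 1) = Θ`. -/
def xVal (η N_B : ℝ) : ℝ :=
  1 - (1 - Theta η N_B) / xDenom η N_B

/-- `ν = (√(G₀ G₁) - √((G₀ - 1)(G₁ - 1)))⁻¹` with `G₀ = N_B + 1`, `G₁ = (1 - η) N_B + 1`. -/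
def nu (η N_B : ℝ) : ℝ :=
  (√((N_B + 1) * ((1 - η) * N_B + 1))
    - √((N_B + 1 - 1) * ((1 - η) * N_B + 1 - 1)))⁻¹

/-- `f = ν (N_B + 1 - N_B / x) [η N_B (1 - x) + 1]`. -/
def fVal (η N_B : ℝ) : ℝ :=
  nu η N_B * (N_B + 1 - N_B / xVal η N_B) * (η * N_B * (1 - xVal η N_B) + 1)

/-- The convergence condition on `x`: it is well defined and `N_B / (N_B + 1) ≤ x ≤ 1`. -/
def ConvergenceCondition (η N_B : ℝ) : Prop :=
  xDenom η N_B ≠ 0 ∧ N_B / (N_B + 1) ≤ xVal η N_B ∧ xVal η N_B ≤ 1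

end CovertQI

end

open scoped ENNReal InnerProductSpace

noncomputable section

namespace CovertQI

/-! ### Bounds on the trace norm -/

/-! Both hypothesis tests are compared through one number, the moment `∑ₙ pₙ Θ^|n|` of the probe's
photon distribution.

Alice. If two states are mixtures of `|u e⟩⟨u e|` and of `|v e⟩⟨v e|`, with total weight one each,
and `c = ∑ Re ⟪u e, v e⟫`, then their trace distance is at most `2 √(1 - c²)`
(`traceNorm_sub_le_of_overlap`). Any Kraus decomposition of the channel may serve, and the choice
decides how good `c` is. Thermal loss equals pure loss followed by quantum-limited amplification, so
its Kraus operators can be labelled by the numbers `l` of lost and `a` of added photons. The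
target-absent state is a mixture of the vectors `√p_th(a) ψ_l ⊗ |a⟩`, with the same labels. Pairing
equal labels singles out the event that all `l` signal photons are lost and `a` thermal ones appear;
its amplitude factors into a function of `a` and `Θ^l`. The sum over `a` gives `ν` per mode, so `c =
ν^M ∑ₙ pₙ Θ^|n|` (`hasSum_overlap`).

Willie. Counting photons cannot increase the trace norm, so covertness puts his two photon-number
distributions within `4ε` in `ℓ¹`, and their Bhattacharyya overlap is at least `1 - 2ε`.
Cauchy-Schwarz with weights `x^(-|j|)` and `x^|j|` bounds its square by a product of two generating
functions. The thermal one is `(N_B + 1 - N_B / x)^(-M)`. The other is `(1 + η N_B (1 - x))^(-M) ∑ₙ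
pₙ T(x)^|n|`, and `x` is chosen so that `T(x) = Θ`. Hence `(1 - 2ε)² f^M ≤ c`, and squaring inside
Alice's bound gives the theorem. The convergence condition keeps `x ≤ 1` and the thermal series
inside, or on the boundary of, its disc of convergence.

The technical core is the decomposition of thermal loss (`bsSum_eq_ampSum`). Both kernels obey the
same recursion in the input photon number and have the same vacuum value. Two Kraus families with
the same single-mode kernel then give the same multi-mode channel
(`IsKrausFamily.tsum_rankOne_vec_eq`). -/

lemma hasSum_of_eq {ι A : Type*} [AddCommMonoid A] [TopologicalSpace A] {f g : ι → A} {a b : A}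
    (h : HasSum f a) (hfg : ∀ i, g i = f i) (hab : b = a) : HasSum g b := by
  rw [hab, funext hfg]; exact h

section TraceNorm

open InnerProductSpace

variable {K : Type*} [NormedAddCommGroup K] [InnerProductSpace ℂ K]

/-- Cauchy-Schwarz over `F`, then Bessel's inequality for each factor; the bound is uniform in `F`.
-/
lemma norm_sum_inner_mul_inner_le {ι : Type*} {v : ι → K} (hv : Orthonormal ℂ v) (F : Finset ι)
    (x y : K) : ‖∑ i ∈ F, ⟪x, v i⟫_ℂ * ⟪v i, y⟫_ℂ‖ ≤ ‖x‖ * ‖y‖ := by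
  calc ‖∑ i ∈ F, ⟪x, v i⟫_ℂ * ⟪v i, y⟫_ℂ‖ ≤ ∑ i ∈ F, ‖⟪v i, x⟫_ℂ‖ * ‖⟪v i, y⟫_ℂ‖ := by
        refine (norm_sum_le _ _).trans_eq (Finset.sum_congr rfl fun i _ => ?_)
        rw [norm_mul, norm_inner_symm]
    _ ≤ √(∑ i ∈ F, ‖⟪v i, x⟫_ℂ‖ ^ 2) * √(∑ i ∈ F, ‖⟪v i, y⟫_ℂ‖ ^ 2) :=
        Real.sum_mul_le_sqrt_mul_sqrt _ _ _
    _ ≤ √(‖x‖ ^ 2) * √(‖y‖ ^ 2) := by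
        gcongr
        · exact hv.sum_inner_products_le x
        · exact hv.sum_inner_products_le y
    _ = ‖x‖ * ‖y‖ := by simp

lemma ofReal_norm_sq_eq_tsum (x : K) {ι : Type*} (v : HilbertBasis ι ℂ K) :
    ENNReal.ofReal (‖x‖ ^ 2) = ∑' i, ENNReal.ofReal (‖⟪v i, x⟫_ℂ‖ ^ 2) := by
  have h := v.hasSum_inner_mul_inner x x
  have h2 : HasSum (fun i => ‖⟪v i, x⟫_ℂ‖ ^ 2) (‖x‖ ^ 2) := by
    have := RCLike.hasSum_re ℂ h
    convert this using 1
    · funext i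
      rw [← inner_conj_symm x, RCLike.conj_mul]
      norm_cast
    · exact (inner_self_eq_norm_sq (𝕜 := ℂ) x).symm
  rw [← h2.tsum_eq, ENNReal.ofReal_tsum_of_nonneg (fun _ => by positivity) h2.summable]

variable [CompleteSpace K]

/-- The sign of `X` would be an exact choice of `S`, but it is discontinuous at `0`. The function `x
/ (|x| + δ)` is a continuous substitute, with error `|x| - x² / (|x| + δ) = δ |x| / (|x| + δ) ≤ δ`.
-/
lemma exists_contraction_mul_near_abs {X : K →L[ℂ] K} (hX : IsSelfAdjoint X) {δ : ℝ}
    (hδ : 0 < δ) : ∃ S : K →L[ℂ] K, ‖S‖ ≤ 1 ∧ ‖CFC.abs X - S * X‖ ≤ δ := by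
  have hpos : ∀ x : ℝ, 0 < |x| + δ := fun x => by positivity
  have hc : Continuous fun x : ℝ => x / (|x| + δ) :=
    continuous_id.div (by fun_prop) fun x => (hpos x).ne'
  refine ⟨cfc (fun x : ℝ => x / (|x| + δ)) X, norm_cfc_le zero_le_one fun x _ => ?_, ?_⟩
  · rw [Real.norm_eq_abs, abs_div, abs_of_pos (hpos x), div_le_one (hpos x)]
    linarith
  · have h : CFC.abs X - cfc (fun x : ℝ => x / (|x| + δ)) X * X
        = cfc (fun x : ℝ => ‖x‖ - x / (|x| + δ) * x) X := by
      conv_lhs => rw [CFC.abs_eq_cfc_norm X hX]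
      conv_lhs => enter [2, 2]; rw [← cfc_id' ℝ X]
      rw [← cfc_mul _ _ X hc.continuousOn (by fun_prop),
        ← cfc_sub _ _ X (by fun_prop) (by fun_prop)]
    rw [h]
    refine norm_cfc_le hδ.le fun x _ => ?_
    have e : ‖x‖ - x / (|x| + δ) * x = δ * (|x| / (|x| + δ)) := by
      have := (hpos x).ne'
      rw [Real.norm_eq_abs]
      field_simp
      nlinarith [sq_abs x]
    have h1 : |x| / (|x| + δ) ≤ 1 := (div_le_one (hpos x)).mpr (by linarith)
    have h0 : 0 ≤ |x| / (|x| + δ) := by positivity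
    rw [e, Real.norm_eq_abs, abs_of_nonneg (by positivity)]
    nlinarith

/-- The trace norm of a self-adjoint sum of rank-one operators `|a⟩⟨b|` is at most
`∑ ‖a‖ ‖b‖`. -/
lemma traceNorm_le_tsum {E : Type*} {X : K →L[ℂ] K} (hX : IsSelfAdjoint X) {a b : E → K}
    (hs : Summable fun e => ‖a e‖ * ‖b e‖) (hab : HasSum (fun e => rankOne ℂ (a e) (b e)) X) :
    traceNorm X ≤ ENNReal.ofReal (∑' e, ‖a e‖ * ‖b e‖) := by
  have habs : ∀ x : K, 0 ≤ RCLike.re ⟪x, CFC.abs X x⟫_ℂ := fun x =>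
    ((ContinuousLinearMap.nonneg_iff_isPositive _).mp (CFC.abs_nonneg X)).re_inner_nonneg_right x
  rw [traceNorm, ENNReal.tsum_eq_iSup_sum]
  refine iSup_le fun F => ?_
  rw [← ENNReal.ofReal_sum_of_nonneg fun i _ => habs _]
  refine ENNReal.ofReal_le_ofReal (le_of_forall_pos_le_add fun ε hε => ?_)
  -- The tolerance is chosen so that the errors over all of `F` add up to at most `ε`.
  obtain ⟨S, hS1, hSX⟩ := exists_contraction_mul_near_abs hX
    (δ := ε / (F.card + 1)) (by positivity)
  have hterm : ∀ x : K, HasSum (fun e => ⟪b e, x⟫_ℂ * ⟪x, S (a e)⟫_ℂ) ⟪x, S (X x)⟫_ℂ := by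
    intro x
    have h := hab.mapL ((ContinuousLinearMap.apply ℂ K x))
    have h2 := h.mapL ((innerSL ℂ x) ∘L S)
    exact hasSum_of_eq h2 (fun e => by simp) rfl
  -- Summing over `F` inside the series lets each rank-one term be bounded by `‖a e‖ ‖b e‖`,
  -- independently of `F`.
  have hsum : HasSum (fun e => ∑ i ∈ F, ⟪b e, onb K i⟫_ℂ * ⟪onb K i, S (a e)⟫_ℂ)
      (∑ i ∈ F, ⟪onb K i, S (X (onb K i))⟫_ℂ) := hasSum_sum fun i _ => hterm _
  have hle : ∀ e, ‖∑ i ∈ F, ⟪b e, onb K i⟫_ℂ * ⟪onb K i, S (a e)⟫_ℂ‖ ≤ ‖a e‖ * ‖b e‖ := by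
    intro e
    refine (norm_sum_inner_mul_inner_le (onb K).orthonormal F _ _).trans ?_
    have : ‖S (a e)‖ ≤ ‖a e‖ := (S.le_of_opNorm_le hS1 _).trans_eq (one_mul _)
    rw [mul_comm]
    gcongr
  have hbound : ‖∑ i ∈ F, ⟪onb K i, S (X (onb K i))⟫_ℂ‖ ≤ ∑' e, ‖a e‖ * ‖b e‖ := by
    rw [← hsum.tsum_eq]
    exact tsum_of_norm_bounded hs.hasSum hle
  have hone : ∀ i, RCLike.re ⟪onb K i, CFC.abs X (onb K i)⟫_ℂ
      ≤ RCLike.re ⟪onb K i, S (X (onb K i))⟫_ℂ + ε / (F.card + 1) := by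
    intro i
    have hn : ‖onb K i‖ = 1 := (onb K).orthonormal.1 i
    have h1 : ‖⟪onb K i, (CFC.abs X - S * X) (onb K i)⟫_ℂ‖ ≤ ε / (F.card + 1) := by
      refine (norm_inner_le_norm _ _).trans ?_
      rw [hn, one_mul]
      exact ((CFC.abs X - S * X).le_of_opNorm_le hSX _).trans_eq (by rw [hn, mul_one])
    have h2 := (RCLike.re_le_norm _).trans h1
    rw [sub_apply, inner_sub_right, map_sub,
      mul_apply_eq_comp] at h2
    linarith
  calc ∑ i ∈ F, RCLike.re ⟪onb K i, CFC.abs X (onb K i)⟫_ℂ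
      ≤ ∑ i ∈ F, (RCLike.re ⟪onb K i, S (X (onb K i))⟫_ℂ + ε / (F.card + 1)) :=
        Finset.sum_le_sum fun i _ => hone i
    _ = RCLike.re (∑ i ∈ F, ⟪onb K i, S (X (onb K i))⟫_ℂ) + F.card * (ε / (F.card + 1)) := by
        rw [Finset.sum_add_distrib, map_sum, Finset.sum_const, nsmul_eq_mul]
    _ ≤ ∑' e, ‖a e‖ * ‖b e‖ + ε := by
        gcongr
        · exact (RCLike.re_le_norm _).trans hbound
        · rw [mul_div_assoc', div_le_iff₀ (by positivity)]
          nlinarith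

/-- With `X = X⁺ - X⁻` and `|X| = X⁺ + X⁻`, this is the triangle inequality for two nonnegative
expectations. -/
lemma norm_inner_self_le_re_inner_abs {X : K →L[ℂ] K} (hX : IsSelfAdjoint X) (x : K) :
    ‖⟪x, X x⟫_ℂ‖ ≤ RCLike.re ⟪x, CFC.abs X x⟫_ℂ := by
  have hp := ((ContinuousLinearMap.nonneg_iff_isPositive _).mp
    (CFC.posPart_nonneg X)).re_inner_nonneg_right x
  have hm := ((ContinuousLinearMap.nonneg_iff_isPositive _).mp
    (CFC.negPart_nonneg X)).re_inner_nonneg_right x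
  have him : RCLike.im ⟪x, X x⟫_ℂ = 0 := by
    have : (starRingEnd ℂ) ⟪x, X x⟫_ℂ = ⟪x, X x⟫_ℂ := by
      rw [inner_conj_symm]
      exact (ContinuousLinearMap.isSelfAdjoint_iff_isSymmetric.mp hX) x x
    exact RCLike.conj_eq_iff_im.mp this
  have hre : ⟪x, X x⟫_ℂ = ((RCLike.re ⟪x, X x⟫_ℂ : ℝ) : ℂ) := by
    apply Complex.ext
    · simp
    · simpa using him
  rw [hre, Complex.norm_real, Real.norm_eq_abs, ← CFC.posPart_add_negPart X hX]
  conv_lhs => rw [← CFC.posPart_sub_negPart X hX]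
  rw [sub_apply, add_apply, inner_sub_right,
    inner_add_right, map_sub, map_add, abs_le]
  constructor <;> linarith

/-- The diagonal of a self-adjoint operator in any orthonormal family is bounded in `ℓ¹` by the
trace norm. -/
lemma tsum_norm_inner_le_traceNorm {ι : Type*} {v : ι → K} (hv : Orthonormal ℂ v)
    {X : K →L[ℂ] K} (hX : IsSelfAdjoint X) :
    ∑' i, ENNReal.ofReal ‖⟪v i, X (v i)⟫_ℂ‖ ≤ traceNorm X := by
  -- Writing `|X| = R²` turns expectations into sums of squared matrix entries of `R`. These may be
  -- summed in either order, which replaces the family `v`, for which only Bessel holds, by the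
  -- basis that defines the trace norm.
  set R := CFC.sqrt (CFC.abs X) with hR
  have hRsa : IsSelfAdjoint R := (CFC.sqrt_nonneg (CFC.abs X)).isSelfAdjoint
  have hRR : R * R = CFC.abs X := CFC.sqrt_mul_sqrt_self _ (CFC.abs_nonneg X)
  have hsymm := ContinuousLinearMap.isSelfAdjoint_iff_isSymmetric.mp hRsa
  have hnorm : ∀ x, RCLike.re ⟪x, CFC.abs X x⟫_ℂ = ‖R x‖ ^ 2 := fun x => by
    rw [← hRR, mul_apply_eq_comp, ← inner_self_eq_norm_sq (𝕜 := ℂ) (R x)]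
    exact congrArg _ (hsymm x (R x)).symm
  calc ∑' i, ENNReal.ofReal ‖⟪v i, X (v i)⟫_ℂ‖
      ≤ ∑' i, ENNReal.ofReal (‖R (v i)‖ ^ 2) := by
        refine ENNReal.tsum_le_tsum fun i => ENNReal.ofReal_le_ofReal ?_
        rw [← hnorm]
        exact norm_inner_self_le_re_inner_abs hX _
    _ = ∑' i, ∑' b, ENNReal.ofReal (‖⟪v i, R (onb K b)⟫_ℂ‖ ^ 2) := by
        refine tsum_congr fun i => ?_
        rw [ofReal_norm_sq_eq_tsum _ (onb K)]
        refine tsum_congr fun b => ?_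
        rw [norm_inner_symm]
        exact congrArg (fun z : ℂ => ENNReal.ofReal (‖z‖ ^ 2)) (hsymm _ _)
    _ = ∑' b, ∑' i, ENNReal.ofReal (‖⟪v i, R (onb K b)⟫_ℂ‖ ^ 2) := ENNReal.tsum_comm
    _ ≤ ∑' b, ENNReal.ofReal (‖R (onb K b)‖ ^ 2) := by
        refine ENNReal.tsum_le_tsum fun b => ?_
        rw [← ENNReal.ofReal_tsum_of_nonneg (fun _ => by positivity)
          (hv.inner_products_summable _)]
        exact ENNReal.ofReal_le_ofReal (hv.tsum_inner_products_le _)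
    _ = traceNorm X := by simp_rw [traceNorm, hnorm]

lemma isSelfAdjoint_of_hasSum {E : Type*} {X : K →L[ℂ] K} {f : E → K →L[ℂ] K}
    (hf : ∀ e, IsSelfAdjoint (f e)) (h : HasSum f X) : IsSelfAdjoint X := by
  have h2 := h.star
  simp_rw [(hf _).star_eq] at h2
  exact h2.unique h

/-- The trace distance of two mixtures, in terms of the overlap of two purifications. -/
lemma traceNorm_sub_le_of_overlap {E : Type*} {u v : E → K} {ρ σ : K →L[ℂ] K} {c : ℝ}
    (hu : HasSum (fun e => ‖u e‖ ^ 2) 1) (hv : HasSum (fun e => ‖v e‖ ^ 2) 1)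
    (hc : HasSum (fun e => RCLike.re ⟪u e, v e⟫_ℂ) c)
    (hρ : HasSum (fun e => rankOne ℂ (u e) (u e)) ρ)
    (hσ : HasSum (fun e => rankOne ℂ (v e) (v e)) σ) :
    traceNorm (ρ - σ) ≤ ENNReal.ofReal (2 * √(1 - c ^ 2)) := by
  have hadd : HasSum (fun e => ‖u e + v e‖ ^ 2) (2 + 2 * c) := by
    exact hasSum_of_eq ((hu.add (hc.mul_left 2)).add hv)
      (fun e => norm_add_sq (𝕜 := ℂ) _ _) (by ring)
  have hsub : HasSum (fun e => ‖u e - v e‖ ^ 2) (2 - 2 * c) := by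
    exact hasSum_of_eq ((hu.sub (hc.mul_left 2)).add hv)
      (fun e => norm_sub_sq (𝕜 := ℂ) _ _) (by ring)
  -- Cauchy-Schwarz over `e`; the two factors are `2 + 2c` and `2 - 2c`, with product `4 (1 - c²)`.
  obtain ⟨hs, hle⟩ := Real.summable_and_inner_le_Lp_mul_Lq_tsum_of_nonneg
    (f := fun e => ‖u e + v e‖) (g := fun e => ‖u e - v e‖) Real.HolderConjugate.two_two
    (fun _ => norm_nonneg _) (fun _ => norm_nonneg _)
    (by simpa using hadd.summable) (by simpa using hsub.summable)
  have hle' : ∑' e, ‖u e + v e‖ * ‖u e - v e‖ ≤ 2 * √(1 - c ^ 2) := by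
    refine hle.trans_eq ?_
    simp only [Real.rpow_ofNat, hadd.tsum_eq, hsub.tsum_eq, ← Real.sqrt_eq_rpow]
    have h0 : 0 ≤ 2 + 2 * c := hadd.nonneg fun _ => by positivity
    rw [← Real.sqrt_mul h0, show (2 + 2 * c) * (2 - 2 * c) = 2 ^ 2 * (1 - c ^ 2) by ring,
      Real.sqrt_mul (by norm_num), Real.sqrt_sq (by norm_num)]
  have hX : IsSelfAdjoint (ρ - σ) :=
    (isSelfAdjoint_of_hasSum (fun e => (isPositive_rankOne_self (u e)).isSelfAdjoint) hρ).sub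
      (isSelfAdjoint_of_hasSum (fun e => (isPositive_rankOne_self (v e)).isSelfAdjoint) hσ)
  -- The identity `|u⟩⟨u| - |v⟩⟨v| = ½ (|u+v⟩⟨u-v| + |u-v⟩⟨u+v|)` uses two rank-one terms per index,
  -- hence the doubled index set.
  set a : E ⊕ E → K := Sum.elim (fun e => (2⁻¹ : ℂ) • (u e + v e)) (fun e => (2⁻¹ : ℂ) • (u e - v e))
  set b : E ⊕ E → K := Sum.elim (fun e => u e - v e) (fun e => u e + v e)
  have hab₁ : ∀ e, ‖a (Sum.inl e)‖ * ‖b (Sum.inl e)‖ = 2⁻¹ * (‖u e + v e‖ * ‖u e - v e‖) := by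
    intro e; simp only [a, b, Sum.elim_inl, norm_smul]; simp [mul_assoc]
  have hab₂ : ∀ e, ‖a (Sum.inr e)‖ * ‖b (Sum.inr e)‖ = 2⁻¹ * (‖u e + v e‖ * ‖u e - v e‖) := by
    intro e; simp only [a, b, Sum.elim_inr, norm_smul]; simp; ring
  have hn : HasSum (fun e => ‖a e‖ * ‖b e‖) (∑' e, ‖u e + v e‖ * ‖u e - v e‖) := by
    have h := hs.hasSum.mul_left 2⁻¹
    have := HasSum.sum (f := fun e => ‖a e‖ * ‖b e‖) (by simpa only [Function.comp_def, hab₁] using h)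
      (by simpa only [Function.comp_def, hab₂] using h)
    convert this using 1
    ring
  have hsumm : Summable fun e => rankOne ℂ (a e) (b e) :=
    Summable.of_norm (by simpa using hn.summable)
  have hval : HasSum (fun e => rankOne ℂ (a e) (b e)) (ρ - σ) := by
    have h1 := (hsumm.comp_injective Sum.inl_injective).hasSum
    have h2 := (hsumm.comp_injective Sum.inr_injective).hasSum
    have h3 := (h1.add h2).unique (a₂ := ρ - σ) (by
      refine hasSum_of_eq (hρ.sub hσ) (fun e => ?_) rfl
      ext x
      simp only [Function.comp_apply, a, b, Sum.elim_inl, Sum.elim_inr, map_smul, map_add, map_sub,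
        add_apply, sub_apply,
        smul_apply, rankOne_apply, smul_sub, smul_add]
      module)
    rw [← h3]
    exact h1.sum h2
  refine (traceNorm_le_tsum hX hn.summable hval).trans ?_
  rw [hn.tsum_eq]
  exact ENNReal.ofReal_le_ofReal hle'

end TraceNorm

/-! ### The kernel of the single-mode thermal loss channel -/

section Coefficients

open MvPolynomial

/-- The coefficient of `xʲ yᵏ`. -/
def coeffXY (f : MvPolynomial (Fin 2) ℝ) (j k : ℕ) : ℝ :=
  f.coeff (Finsupp.single 0 j + Finsupp.single 1 k)

lemma coeffXY_add (f g : MvPolynomial (Fin 2) ℝ) (j k : ℕ) :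
    coeffXY (f + g) j k = coeffXY f j k + coeffXY g j k := coeff_add ..

lemma coeffXY_sub (f g : MvPolynomial (Fin 2) ℝ) (j k : ℕ) :
    coeffXY (f - g) j k = coeffXY f j k - coeffXY g j k := coeff_sub ..

lemma coeffXY_C_mul (c : ℝ) (f : MvPolynomial (Fin 2) ℝ) (j k : ℕ) :
    coeffXY (C c * f) j k = c * coeffXY f j k := coeff_C_mul ..

lemma coeffXY_X_zero_mul (f : MvPolynomial (Fin 2) ℝ) (j k : ℕ) :
    coeffXY (X 0 * f) j k = if j = 0 then 0 else coeffXY f (j - 1) k := by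
  cases j with
  | zero => simp [coeffXY, coeff_X_mul']
  | succ j =>
    have : (Finsupp.single 0 (j + 1) + Finsupp.single 1 k : Fin 2 →₀ ℕ)
        = Finsupp.single 0 1 + (Finsupp.single 0 j + Finsupp.single 1 k) := by
      rw [← add_assoc, ← Finsupp.single_add, add_comm 1 j]
    rw [coeffXY, this, coeff_X_mul, if_neg j.succ_ne_zero]; rfl

lemma coeffXY_X_one_mul (f : MvPolynomial (Fin 2) ℝ) (j k : ℕ) :
    coeffXY (X 1 * f) j k = if k = 0 then 0 else coeffXY f j (k - 1) := by
  cases k with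
  | zero => simp [coeffXY, coeff_X_mul']
  | succ k =>
    have : (Finsupp.single 0 j + Finsupp.single 1 (k + 1) : Fin 2 →₀ ℕ)
        = Finsupp.single 1 1 + (Finsupp.single 0 j + Finsupp.single 1 k) := by
      rw [add_left_comm, ← Finsupp.single_add, add_comm 1 k]
    rw [coeffXY, this, coeff_X_mul, if_neg k.succ_ne_zero]; rfl

lemma coeffXY_pderiv_one (f : MvPolynomial (Fin 2) ℝ) (j k : ℕ) :
    coeffXY (pderiv 1 f) j k = (k + 1) * coeffXY f j (k + 1) := by
  rw [coeffXY, coeff_pderiv, coeffXY, add_assoc, ← Finsupp.single_add]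
  simp [mul_comm]

/-- The coefficients of `bsPoly`. -/
def bsCoeff (κ : unitInterval) (n m j k : ℕ) : ℝ :=
  coeffXY (bsPoly κ n m) j k

variable (κ : unitInterval)

lemma bsCoeff_succ_left (n m j k : ℕ) :
    bsCoeff κ (n + 1) m j k = √(κ : ℝ) * (if j = 0 then 0 else bsCoeff κ n m (j - 1) k)
      + √(1 - (κ : ℝ)) * (if k = 0 then 0 else bsCoeff κ n m j (k - 1)) := by
  have : bsPoly κ (n + 1) m = C (√(κ : ℝ)) * (X 0 * bsPoly κ n m)
      + C (√(1 - (κ : ℝ))) * (X 1 * bsPoly κ n m) := by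
    simp only [bsPoly]; ring
  simp only [bsCoeff, this, coeffXY_add, coeffXY_C_mul, coeffXY_X_zero_mul, coeffXY_X_one_mul]

lemma bsCoeff_succ_right (n m j k : ℕ) :
    bsCoeff κ n (m + 1) j k = √(1 - (κ : ℝ)) * (if j = 0 then 0 else bsCoeff κ n m (j - 1) k)
      - √(κ : ℝ) * (if k = 0 then 0 else bsCoeff κ n m j (k - 1)) := by
  have : bsPoly κ n (m + 1) = C (√(1 - (κ : ℝ))) * (X 0 * bsPoly κ n m)
      - C (√(κ : ℝ)) * (X 1 * bsPoly κ n m) := by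
    simp only [bsPoly]; ring
  simp only [bsCoeff, this, coeffXY_sub, coeffXY_C_mul, coeffXY_X_zero_mul, coeffXY_X_one_mul]

/-- Differentiation in `y` annihilates an environment photon, which by the product rule came either
from the signal or from the background input. -/
lemma succ_mul_bsCoeff_succ (n m j k : ℕ) :
    (k + 1) * bsCoeff κ n m j (k + 1) = √(1 - (κ : ℝ)) * (n * bsCoeff κ (n - 1) m j k)
      - √(κ : ℝ) * (m * bsCoeff κ n (m - 1) j k) := by
  have : pderiv 1 (bsPoly κ n m) = C (√(1 - (κ : ℝ))) * (C (n : ℝ) * bsPoly κ (n - 1) m)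
      - C (√(κ : ℝ)) * (C (m : ℝ) * bsPoly κ n (m - 1)) := by
    simp only [bsPoly, Derivation.leibniz, Derivation.leibniz_pow, smul_eq_mul, nsmul_eq_mul,
      map_add, map_sub, pderiv_C, pderiv_X_self, map_natCast,
      pderiv_X_of_ne (show (0 : Fin 2) ≠ 1 by decide)]
    ring
  simp only [bsCoeff, ← coeffXY_pderiv_one, this, coeffXY_sub, coeffXY_C_mul]

/-- The polynomial is homogeneous of degree `n + m`: the beam splitter conserves photons. -/
lemma bsCoeff_eq_zero {n m j k : ℕ} (h : n + m ≠ j + k) : bsCoeff κ n m j k = 0 := by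
  have hP : (bsPoly κ n m).IsHomogeneous (n * 1 + m * 1) := by
    rw [mul_comm n, mul_comm m]
    refine IsHomogeneous.mul (IsHomogeneous.pow ?_ n) (IsHomogeneous.pow ?_ m)
    · exact (isHomogeneous_C_mul_X _ _).add (isHomogeneous_C_mul_X _ _)
    · exact (isHomogeneous_C_mul_X _ _).sub (isHomogeneous_C_mul_X _ _)
  refine hP.coeff_eq_zero ?_
  simp only [map_add, Finsupp.degree_single]
  omega

lemma bsCoeff_zero_left (m j k : ℕ) :
    bsCoeff κ 0 m j k =
      if m = j + k then (m.choose j : ℝ) * √(1 - (κ : ℝ)) ^ j * (-√(κ : ℝ)) ^ k else 0 := by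
  induction m generalizing j k with
  | zero =>
    split_ifs with h
    · obtain ⟨rfl, rfl⟩ : j = 0 ∧ k = 0 := by omega
      simp [bsCoeff, coeffXY, bsPoly]
    · exact bsCoeff_eq_zero κ (by omega)
  | succ m ih =>
    split_ifs with h
    · rw [bsCoeff_succ_right]
      rcases j with _ | j
      · rcases k with _ | k
        · omega
        · have h1 : m = k := by omega
          simp [ih, h1.symm, pow_succ]
          ring
      · rcases k with _ | k
        · have h1 : m = j := by omega
          simp [ih, h1.symm, pow_succ]
          ring
        · have h1 : m = j + (k + 1) := by omega
          have h2 : m = (j + 1) + k := by omega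
          simp only [Nat.add_eq_zero_iff, one_ne_zero, and_false, if_false, Nat.add_sub_cancel, ih,
            if_pos h1, if_pos h2, Nat.choose_succ_succ]
          push_cast
          ring
    · exact bsCoeff_eq_zero κ (by omega)

lemma bsAmp_eq (n m j k : ℕ) :
    bsAmp κ n m j k =
      √((j.factorial * k.factorial : ℝ) / (n.factorial * m.factorial)) * bsCoeff κ n m j k := rfl

end Coefficients

/-! ### Recursion and vacuum value of the beam-splitter kernel -/

section BeamSplitterKernel

/-- The number distribution of the single-mode thermal state. -/
def thermalProb (N : ℝ) (m : ℕ) : ℝ := N ^ m / (N + 1) ^ (m + 1)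

lemma thermalProb_nonneg {N : ℝ} (hN : 0 ≤ N) (m : ℕ) : 0 ≤ thermalProb N m := by
  unfold thermalProb; positivity

lemma thermalProb_eq {N : ℝ} (hN : 0 ≤ N) (m : ℕ) :
    thermalProb N m = (N + 1)⁻¹ * (N / (N + 1)) ^ m := by
  have : N + 1 ≠ 0 := by positivity
  rw [thermalProb, div_pow, pow_succ]
  field_simp

lemma thermalProb_succ {N : ℝ} (hN : 0 ≤ N) (m : ℕ) :
    thermalProb N (m + 1) = N / (N + 1) * thermalProb N m := by
  rw [thermalProb_eq hN, thermalProb_eq hN, pow_succ]; ring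

lemma hasSum_thermalProb {N : ℝ} (hN : 0 ≤ N) : HasSum (thermalProb N) 1 := by
  have h1 : N + 1 ≠ 0 := by positivity
  have hlt : N / (N + 1) < 1 := by rw [div_lt_one (by positivity)]; linarith
  refine hasSum_of_eq ((hasSum_geometric_of_lt_one (by positivity) hlt).mul_left (N + 1)⁻¹)
    (thermalProb_eq hN) ?_
  field_simp
  ring

lemma hasSum_of_succ_fst {f : ℕ × ℕ → ℝ} {a : ℝ} (h0 : ∀ k, f (0, k) = 0)
    (h : HasSum (fun e : ℕ × ℕ => f (e.1 + 1, e.2)) a) : HasSum f a := by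
  have hinj : Function.Injective fun e : ℕ × ℕ => (e.1 + 1, e.2) := by
    rintro ⟨a, b⟩ ⟨c, d⟩ h; simpa using h
  refine (hinj.hasSum_iff ?_).mp h
  rintro ⟨m, k⟩ hmk
  rcases m with _ | m
  · exact h0 k
  · exact absurd ⟨(m, k), rfl⟩ hmk

lemma hasSum_succ_snd_iff {f : ℕ × ℕ → ℝ} {a : ℝ} (h0 : ∀ m, f (m, 0) = 0) :
    HasSum (fun e : ℕ × ℕ => f (e.1, e.2 + 1)) a ↔ HasSum f a := by
  have hinj : Function.Injective fun e : ℕ × ℕ => (e.1, e.2 + 1) := by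
    rintro ⟨a, b⟩ ⟨c, d⟩ h; simpa using h
  refine hinj.hasSum_iff ?_
  rintro ⟨m, k⟩ hmk
  rcases k with _ | k
  · exact h0 m
  · exact absurd ⟨(m, k), rfl⟩ hmk

variable (κ : unitInterval) (N : ℝ)

/-- The summand of the (unnormalised) kernel of the thermal loss channel, indexed by the photon
numbers of the background input and the environment output. -/
def bsTerm (n n' j j' : ℕ) (e : ℕ × ℕ) : ℝ :=
  thermalProb N e.1 * (e.2.factorial / e.1.factorial)
    * bsCoeff κ n e.1 j e.2 * bsCoeff κ n' e.1 j' e.2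

/-- The kernel of the thermal loss channel with respect to monomials. -/
def bsSum (n n' j j' : ℕ) : ℝ := ∑' e, bsTerm κ N n n' j j' e

lemma bsSum_symm (n n' j j' : ℕ) : bsSum κ N n n' j j' = bsSum κ N n' n j' j :=
  tsum_congr fun e => by unfold bsTerm; ring

lemma factorial_div_mul_sq_bsCoeff_le (n m j k : ℕ) :
    (k.factorial / m.factorial : ℝ) * bsCoeff κ n m j k ^ 2 ≤ n.factorial := by
  have h := abs_bsAmp_le_one κ n m j k
  rw [← sq_le_one_iff_abs_le_one, bsAmp_eq, mul_pow, Real.sq_sqrt (by positivity)] at h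
  have hj : (1 : ℝ) ≤ j.factorial := by exact_mod_cast j.factorial_pos
  calc (k.factorial / m.factorial : ℝ) * bsCoeff κ n m j k ^ 2
      ≤ j.factorial * ((k.factorial / m.factorial : ℝ) * bsCoeff κ n m j k ^ 2) :=
        le_mul_of_one_le_left (by positivity) hj
    _ = n.factorial * ((j.factorial * k.factorial : ℝ) / (n.factorial * m.factorial)
          * bsCoeff κ n m j k ^ 2) := by
        have : (n.factorial : ℝ) ≠ 0 := by positivity
        field_simp
    _ ≤ n.factorial := mul_le_of_le_one_right (by positivity) h

variable {N}

/-- Photon conservation leaves `m` as the only free index, with `k = n + m - j`. Since beam-splitter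
amplitudes have modulus at most one, the terms are dominated by a multiple of the thermal
distribution. -/
lemma summable_bsTerm (hN : 0 ≤ N) (n n' j j' : ℕ) : Summable (bsTerm κ N n n' j j') := by
  have hinj : Function.Injective fun m : ℕ => (m, n + m - j) := fun a b h => (Prod.ext_iff.mp h).1
  rw [← hinj.summable_iff]
  · refine Summable.of_norm_bounded
      ((hasSum_thermalProb hN).summable.mul_right ((n.factorial : ℝ) + n'.factorial)) fun m => ?_
    simp only [Function.comp_apply, bsTerm]
    have h1 := factorial_div_mul_sq_bsCoeff_le κ n m j (n + m - j)
    have h2 := factorial_div_mul_sq_bsCoeff_le κ n' m j' (n + m - j)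
    set q : ℝ := (n + m - j).factorial / m.factorial
    set c := bsCoeff κ n m j (n + m - j)
    set d := bsCoeff κ n' m j' (n + m - j)
    have hq : 0 ≤ q := by positivity
    have hp := thermalProb_nonneg hN m
    have hcd : |c * d| ≤ c ^ 2 + d ^ 2 := by
      rw [abs_le]; constructor <;> nlinarith [sq_nonneg (c + d), sq_nonneg (c - d)]
    rw [Real.norm_eq_abs, mul_assoc, mul_assoc, abs_mul, abs_mul, abs_of_nonneg hp,
      abs_of_nonneg hq]
    refine mul_le_mul_of_nonneg_left ?_ hp
    nlinarith
  · rintro ⟨m, k⟩ h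
    have : n + m ≠ j + k := fun h' => h ⟨m, by simp; omega⟩
    simp [bsTerm, bsCoeff_eq_zero κ this]

lemma hasSum_bsTerm (hN : 0 ≤ N) (n n' j j' : ℕ) :
    HasSum (bsTerm κ N n n' j j') (bsSum κ N n n' j j') :=
  (summable_bsTerm κ hN n n' j j').hasSum

set_option maxHeartbeats 1000000 in
-- Split off one factor `√κ x + √(1-κ) y` for the extra signal photon. The `x` part gives the `j -
-- 1` term, and the `y` part leaves a series `Z` with an extra environment photon. Moving that
-- photon to the second amplitude by differentiation expresses `Z` through the kernel at `n' - 1`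
-- and a series with one background photon fewer in the second amplitude. Shifting the background
-- index and using the geometric thermal weights brings the latter back to `Z`. The resulting linear
-- equation is solved for `Z`.
lemma bsSum_succ (hN : 0 ≤ N) (h1 : (κ : ℝ) < 1) (n n' j j' : ℕ) :
    bsSum κ N (n + 1) n' j j' =
      √(κ : ℝ) / (1 + (1 - κ) * N) * (if j = 0 then 0 else bsSum κ N n n' (j - 1) j')
      + (1 - κ) * (N + 1) / (1 + (1 - κ) * N) * (n' * bsSum κ N n (n' - 1) j j') := by
  have ht : √(κ : ℝ) ^ 2 = κ := Real.sq_sqrt κ.2.1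
  have hr : √(1 - (κ : ℝ)) ^ 2 = 1 - κ := Real.sq_sqrt (sub_nonneg.mpr κ.2.2)
  have hr0 : √(1 - (κ : ℝ)) ≠ 0 := (Real.sqrt_pos.mpr (sub_pos.mpr h1)).ne'
  set t := √(κ : ℝ) with htdef
  set r := √(1 - (κ : ℝ)) with hrdef
  set prev : ℕ × ℕ → ℝ := fun e => if j = 0 then 0 else bsTerm κ N n n' (j - 1) j' e with hprev
  set sprev : ℝ := if j = 0 then 0 else bsSum κ N n n' (j - 1) j' with hsprev
  have hP : HasSum prev sprev := by
    by_cases h : j = 0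
    · simp only [hprev, hsprev, h, if_true]; exact hasSum_zero
    · simp only [hprev, hsprev, h, if_false]; exact hasSum_bsTerm κ hN _ _ _ _
  set z : ℕ × ℕ → ℝ := fun e => thermalProb N e.1 * ((e.2 + 1).factorial / e.1.factorial)
    * bsCoeff κ n e.1 j e.2 * bsCoeff κ n' e.1 j' (e.2 + 1) with hz
  set zs : ℕ × ℕ → ℝ := fun e => if e.2 = 0 then 0 else z (e.1, e.2 - 1) with hzs
  set y : ℕ × ℕ → ℝ := fun e => if e.1 = 0 then 0 else
    thermalProb N e.1 * (e.2.factorial / (e.1 - 1).factorial)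
    * bsCoeff κ n e.1 j e.2 * bsCoeff κ n' (e.1 - 1) j' e.2 with hy
  set Z : ℝ := (bsSum κ N (n + 1) n' j j' - t * sprev) / r with hZ
  have hzs_eq : ∀ e, zs e = (bsTerm κ N (n + 1) n' j j' e - t * prev e) / r := by
    rintro ⟨m, k⟩
    rw [eq_div_iff hr0]
    simp only [bsTerm, bsCoeff_succ_left, ← htdef, ← hrdef, hzs, hprev, hz]
    rcases k with _ | k
    · simp only [if_true]
      split_ifs <;> ring
    · simp only [Nat.add_eq_zero_iff, one_ne_zero, and_false, if_false, Nat.add_sub_cancel]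
      split_ifs <;> ring
  have hZs : HasSum zs Z :=
    hasSum_of_eq (((hasSum_bsTerm κ hN _ _ _ _).sub (hP.mul_left t)).div_const r) hzs_eq rfl
  have hZz : HasSum z Z := (hasSum_succ_snd_iff (f := zs) fun _ => rfl).mpr hZs
  -- The shift `m ↦ m + 1` costs the thermal ratio `N / (N + 1)`; the surplus background photon in
  -- the first amplitude is then split off as `√(1-κ) x - √κ y`.
  have hY : HasSum y (N / (N + 1) * (r * sprev - t * Z)) := by
    refine hasSum_of_succ_fst (fun _ => rfl)
      (hasSum_of_eq (((hP.mul_left r).sub (hZs.mul_left t)).mul_left (N / (N + 1))) ?_ rfl)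
    · rintro ⟨m, k⟩
      simp only [hy, Nat.add_eq_zero_iff, one_ne_zero, and_false, if_false,
        Nat.add_sub_cancel, bsCoeff_succ_right, ← htdef, ← hrdef, hprev, hzs, hz, bsTerm,
        thermalProb_succ hN]
      rcases k with _ | k
      · simp only [if_true]
        split_ifs <;> ring
      · simp only [Nat.add_eq_zero_iff, one_ne_zero, and_false, if_false, Nat.add_sub_cancel]
        split_ifs <;> ring
  have hZ2 : HasSum z (r * (n' * bsSum κ N n (n' - 1) j j')
      - t * (N / (N + 1) * (r * sprev - t * Z))) := by
    refine hasSum_of_eq ((((hasSum_bsTerm κ hN n (n' - 1) j j').mul_left (n' : ℝ)).mul_left r).sub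
      (hY.mul_left t)) ?_ rfl
    rintro ⟨m, k⟩
    have hk := succ_mul_bsCoeff_succ κ n' m j' k
    rw [← htdef, ← hrdef] at hk
    simp only [hz, hy, bsTerm, Nat.factorial_succ]
    push_cast
    rcases m with _ | m
    · simp only [if_true]
      linear_combination (thermalProb N 0 * (k.factorial / (Nat.factorial 0 : ℝ))
        * bsCoeff κ n 0 j k) * hk
    · simp only [Nat.add_eq_zero_iff, one_ne_zero, and_false, if_false, Nat.add_sub_cancel]
        at hk ⊢
      have hm : ((m : ℝ) + 1) / (m + 1).factorial = 1 / m.factorial := by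
        rw [Nat.factorial_succ]; push_cast
        have : (m : ℝ) + 1 ≠ 0 := by positivity
        field_simp
      push_cast at hk
      linear_combination (thermalProb N (m + 1) * (k.factorial / ((m + 1).factorial : ℝ))
        * bsCoeff κ n (m + 1) j k) * hk
        - t * thermalProb N (m + 1) * k.factorial * bsCoeff κ n (m + 1) j k
          * bsCoeff κ n' m j' k * hm
  have hZeq := hZz.unique hZ2
  have hs : bsSum κ N (n + 1) n' j j' = t * sprev + r * Z := by
    rw [hZ]; field_simp; ring
  have hN1 : N + 1 ≠ 0 := by positivity
  have hG : 1 + (1 - (κ : ℝ)) * N ≠ 0 := by nlinarith [mul_nonneg (sub_nonneg.mpr h1.le) hN]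
  have hZsol : Z * (1 + (1 - (κ : ℝ)) * N) =
      r * (n' * bsSum κ N n (n' - 1) j j') * (N + 1) - t * N * r * sprev := by
    have hNN : N / (N + 1) * (N + 1) = N := by field_simp
    linear_combination (N + 1) * hZeq - (t * r * sprev - t ^ 2 * Z) * hNN + N * Z * ht
  rw [hs]
  field_simp
  linear_combination r * hZsol + (n' * bsSum κ N n (n' - 1) j j' * (N + 1) - t * N * sprev) * hr

lemma bsSum_zero_zero (hN : 0 ≤ N) (h1 : (κ : ℝ) < 1) (j j' : ℕ) :
    bsSum κ N 0 0 j j' = if j = j' then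
      ((1 - κ) * N / (1 + (1 - κ) * N)) ^ j / (j.factorial * (1 + (1 - κ) * N)) else 0 := by
  have ht : √(κ : ℝ) ^ 2 = κ := Real.sq_sqrt κ.2.1
  have hr : √(1 - (κ : ℝ)) ^ 2 = 1 - κ := Real.sq_sqrt (sub_nonneg.mpr κ.2.2)
  split_ifs with hjj
  · subst hjj
    have hN1 : N + 1 ≠ 0 := by positivity
    have hGpos : 0 < 1 + (1 - (κ : ℝ)) * N := by nlinarith [mul_nonneg (sub_nonneg.mpr h1.le) hN]
    have hG := hGpos.ne'
    have hκ0 : 0 ≤ (κ : ℝ) := κ.2.1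
    have hq : ‖N / (N + 1) * κ‖ < 1 := by
      rw [Real.norm_eq_abs, abs_of_nonneg (by positivity), div_mul_eq_mul_div,
        div_lt_one (by positivity)]
      nlinarith
    -- With vacuum input, only `m = j + k` contributes and the sum over `k` is a negative binomial
    -- series.
    have hsum := (hasSum_choose_mul_geometric_of_norm_lt_one j hq).mul_left
      (((N + 1)⁻¹ * (N / (N + 1)) ^ j) * (1 - κ) ^ j / j.factorial)
    have hinj : Function.Injective fun k : ℕ => (j + k, k) := fun a b h => (Prod.ext_iff.mp h).2
    refine HasSum.tsum_eq ((hinj.hasSum_iff ?_).mp (hasSum_of_eq hsum ?_ ?_))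
    · rintro ⟨m, k⟩ h
      have : m ≠ j + k := fun h' => h ⟨k, by simp [h']⟩
      simp [bsTerm, bsCoeff_zero_left, this]
    · intro k
      simp only [Function.comp_apply, bsTerm, bsCoeff_zero_left, if_true, thermalProb_eq hN]
      have hch : ((j + k).choose j : ℝ) * (k.factorial / (j + k).factorial) = 1 / j.factorial := by
        have := Nat.choose_mul_factorial_mul_factorial (Nat.le_add_right j k)
        rw [Nat.add_sub_cancel_left] at this
        have h2 : ((j + k).choose j : ℝ) * j.factorial * k.factorial = (j + k).factorial := by
          exact_mod_cast this
        rw [← h2]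
        have : ((j + k).choose j : ℝ) ≠ 0 := by
          exact_mod_cast (Nat.choose_pos (Nat.le_add_right j k)).ne'
        field_simp
      have e1 : (1 - (κ : ℝ)) ^ j = √(1 - (κ : ℝ)) ^ j * √(1 - (κ : ℝ)) ^ j := by
        rw [← mul_pow, ← sq, hr]
      have e2 : (κ : ℝ) ^ k = (-√(κ : ℝ)) ^ k * (-√(κ : ℝ)) ^ k := by
        rw [← mul_pow, neg_mul_neg, ← sq, ht]
      rw [mul_pow, add_comm k j, e1, e2, pow_add]
      linear_combination ((N + 1)⁻¹ * ((N / (N + 1)) ^ j * (N / (N + 1)) ^ k)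
          * √(1 - (κ : ℝ)) ^ j * √(1 - (κ : ℝ)) ^ j * ((-√(κ : ℝ)) ^ k * (-√(κ : ℝ)) ^ k)
          * (j + k).choose j) * hch
    · have h3 : 1 - N / (N + 1) * (κ : ℝ) = (1 + (1 - κ) * N) / (N + 1) := by
        field_simp; ring
      rw [h3]
      simp only [div_pow, mul_pow, pow_succ]
      field_simp
  · refine (tsum_congr fun e => ?_).trans tsum_zero
    obtain ⟨m, k⟩ := e
    simp only [bsTerm, bsCoeff_zero_left]
    split_ifs with h2 h3
    · omega
    all_goals simp

end BeamSplitterKernel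

/-! ### Decomposition of thermal loss into pure loss followed by quantum-limited amplification -/

section Amplifier

variable (κ N : ℝ)

/-- The gain `1 + (1 - κ) N` of the amplifier. -/
def gain : ℝ := 1 + (1 - κ) * N

/-- Loss parameter: one minus the transmittance of the pure-loss part. -/
def lossParam : ℝ := (1 - κ) * (N + 1) / gain κ N

/-- Amplification parameter `(G - 1) / G`. -/
def ampParam : ℝ := (1 - κ) * N / gain κ N

/-- Unnormalised amplitude, from `n` to `j` photons, for losing `l` photons in the pure-loss part
and adding `a` photons in the amplification part. -/
def ampCoeff (n a j l : ℕ) : ℝ :=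
  if n + a = j + l then n.descFactorial l * (√κ / gain κ N) ^ (n - l) else 0

/-- The weight of the Kraus operator losing `l` and adding `a` photons. -/
def ampWeight (a l : ℕ) : ℝ :=
  lossParam κ N ^ l / l.factorial * (ampParam κ N ^ a / a.factorial) / gain κ N

/-- The summand of the kernel of loss followed by amplification, indexed by the numbers of added
and of lost photons. -/
def ampTerm (n n' j j' : ℕ) (e : ℕ × ℕ) : ℝ :=
  ampWeight κ N e.1 e.2 * ampCoeff κ N n e.1 j e.2 * ampCoeff κ N n' e.1 j' e.2

/-- The kernel of loss followed by amplification, with respect to monomials. -/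
def ampSum (n n' j j' : ℕ) : ℝ := ∑' e, ampTerm κ N n n' j j' e

lemma ampSum_symm (n n' j j' : ℕ) : ampSum κ N n n' j j' = ampSum κ N n' n j' j :=
  tsum_congr fun e => by unfold ampTerm; ring

lemma ampCoeff_of_lt {n l : ℕ} (h : n < l) (a j : ℕ) : ampCoeff κ N n a j l = 0 := by
  simp [ampCoeff, Nat.descFactorial_eq_zero_iff_lt.mpr h]

/-- Conservation fixes `a = j + l - n`, and at most `n` photons can be lost. When `j + l < n` the
truncated subtraction gives `a = 0`, which violates conservation, so the term vanishes. -/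
lemma hasSum_ampTerm_of_range (n n' j j' : ℕ) :
    HasSum (ampTerm κ N n n' j j')
      (∑ l ∈ Finset.range (n + 1), ampTerm κ N n n' j j' (j + l - n, l)) := by
  have hinj : Function.Injective fun l : ℕ => (j + l - n, l) := fun a b h => (Prod.ext_iff.mp h).2
  refine (hinj.hasSum_iff ?_).mp (hasSum_sum_of_ne_finset_zero fun l hl => ?_)
  · rintro ⟨a, l⟩ h
    have : n + a ≠ j + l := fun h' => h ⟨l, by simp; omega⟩
    simp [ampTerm, ampCoeff, this]
  · have : n < l := by simpa using hl
    simp [ampTerm, ampCoeff_of_lt κ N this]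

lemma hasSum_ampTerm (n n' j j' : ℕ) :
    HasSum (ampTerm κ N n n' j j') (ampSum κ N n n' j j') :=
  (hasSum_ampTerm_of_range κ N n n' j j').summable.hasSum

/-- The extra photon is either transmitted, which requires `j ≠ 0`, or is one of the `l` lost ones:
a Pascal rule for descending factorials. At `l = 0` the factor `l` cancels the truncated index `l -
1`. -/
lemma ampCoeff_succ (n a j l : ℕ) :
    ampCoeff κ N (n + 1) a j l =
      √κ / gain κ N * (if j = 0 then 0 else ampCoeff κ N n a (j - 1) l)
        + l * ampCoeff κ N n a j (l - 1) := by
  set g := √κ / gain κ N with hg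
  by_cases h : n + 1 + a = j + l
  · rcases l with _ | l
    · have hj : j ≠ 0 := by omega
      have h' : n + a = j - 1 := by omega
      simp only [ampCoeff, h, h', hj, if_true, if_false, ← hg, add_zero]
      simp [pow_succ']
    · have h2 : n + a = j + l := by omega
      simp only [ampCoeff, h, h2, if_true, Nat.add_sub_cancel, ← hg, Nat.succ_descFactorial_succ,
        Nat.add_sub_add_right]
      rcases Nat.lt_trichotomy l n with hl | hl | hl
      · obtain ⟨d, rfl⟩ : ∃ d, n = l + 1 + d := ⟨n - (l + 1), by omega⟩
        have hj : j ≠ 0 := by omega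
        have h3 : j + l = j - 1 + (l + 1) := by omega
        have e1 : l + 1 + d - l = d + 1 := by omega
        have e2 : l + 1 + d - (l + 1) = d := by omega
        rw [if_neg hj, if_pos h3, Nat.descFactorial_succ, e1, e2]
        push_cast
        ring
      · subst hl
        simp
      · have h4 : n.descFactorial l = 0 := Nat.descFactorial_eq_zero_iff_lt.mpr hl
        simp [h4]
  · have h1 : ampCoeff κ N (n + 1) a j l = 0 := by simp [ampCoeff, h]
    have h2 : (if j = 0 then 0 else ampCoeff κ N n a (j - 1) l) = 0 := by
      split_ifs with hj
      · rfl
      · have : n + a ≠ j - 1 + l := by omega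
        simp [ampCoeff, this]
    have h3 : (l : ℝ) * ampCoeff κ N n a j (l - 1) = 0 := by
      rcases l with _ | l
      · simp
      · have : n + a ≠ j + l := by omega
        simp [ampCoeff, this]
    rw [h1, h2, h3]; ring

lemma ampCoeff_succ_right (n a j l : ℕ) :
    ampCoeff κ N n a j (l + 1) = n * ampCoeff κ N (n - 1) a j l := by
  rcases n with _ | n
  · simp [ampCoeff]
  · have h : n + 1 + a = j + (l + 1) ↔ n + a = j + l := by omega
    simp only [ampCoeff, h, Nat.succ_descFactorial_succ, Nat.add_sub_add_right, Nat.add_sub_cancel]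
    split_ifs
    · push_cast; ring
    · ring

lemma ampWeight_succ_right (a l : ℕ) :
    ampWeight κ N a (l + 1) * (l + 1) = lossParam κ N * ampWeight κ N a l := by
  have : (l : ℝ) + 1 ≠ 0 := by positivity
  rw [ampWeight, ampWeight, Nat.factorial_succ, pow_succ]
  push_cast
  field_simp

lemma ampSum_succ (n n' j j' : ℕ) :
    ampSum κ N (n + 1) n' j j' =
      √κ / gain κ N * (if j = 0 then 0 else ampSum κ N n n' (j - 1) j')
      + lossParam κ N * (n' * ampSum κ N n (n' - 1) j j') := by
  set prev : ℕ × ℕ → ℝ := fun e => if j = 0 then 0 else ampTerm κ N n n' (j - 1) j' e with hprev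
  have hP : HasSum prev (if j = 0 then 0 else ampSum κ N n n' (j - 1) j') := by
    by_cases h : j = 0
    · simp only [hprev, h, if_true]; exact hasSum_zero
    · simp only [hprev, h, if_false]; exact hasSum_ampTerm κ N _ _ _ _
  set y : ℕ × ℕ → ℝ := fun e => ampWeight κ N e.1 e.2 * (e.2 * ampCoeff κ N n e.1 j (e.2 - 1))
    * ampCoeff κ N n' e.1 j' e.2 with hy
  have hY : HasSum y (lossParam κ N * (n' * ampSum κ N n (n' - 1) j j')) := by
    refine (hasSum_succ_snd_iff (fun m => by simp [hy])).mp
      (hasSum_of_eq (((hasSum_ampTerm κ N n (n' - 1) j j').mul_left (n' : ℝ)).mul_left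
        (lossParam κ N)) ?_ rfl)
    rintro ⟨a, l⟩
    simp only [hy, ampTerm, ampCoeff_succ_right, Nat.add_sub_cancel]
    push_cast
    linear_combination (ampCoeff κ N n a j l * (n' * ampCoeff κ N (n' - 1) a j' l))
      * ampWeight_succ_right κ N a l
  refine (hasSum_ampTerm κ N (n + 1) n' j j').unique
    (hasSum_of_eq ((hP.mul_left (√κ / gain κ N)).add hY) ?_ rfl)
  rintro ⟨a, l⟩
  simp only [ampTerm, ampCoeff_succ, hprev, hy]
  split_ifs <;> ring

lemma ampSum_zero_zero (j j' : ℕ) :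
    ampSum κ N 0 0 j j' =
      if j = j' then ampParam κ N ^ j / (j.factorial * gain κ N) else 0 := by
  rw [ampSum, (hasSum_ampTerm_of_range κ N 0 0 j j').tsum_eq]
  simp only [zero_add, Finset.range_one, Finset.sum_singleton, ampTerm, ampCoeff, ampWeight]
  by_cases h : j = j'
  · subst h; simp; field_simp
  · simp [h]

end Amplifier

/-! ### Equality of the two kernels and the output generating function -/

section KernelIdentity

variable {κ : unitInterval} {N : ℝ}

lemma gain_pos (hN : 0 ≤ N) (κ : unitInterval) : 0 < gain κ N := by
  have := mul_nonneg (sub_nonneg.mpr κ.2.2) hN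
  unfold gain
  linarith

/-- Thermal loss is pure loss followed by quantum-limited amplification. -/
lemma bsSum_eq_ampSum (hN : 0 ≤ N) (h1 : (κ : ℝ) < 1) (n n' j j' : ℕ) :
    bsSum κ N n n' j j' = ampSum κ N n n' j j' := by
  have hrec : ∀ n n' j j', bsSum κ N (n + 1) n' j j' =
      √(κ : ℝ) / gain κ N * (if j = 0 then 0 else bsSum κ N n n' (j - 1) j')
      + lossParam κ N * (n' * bsSum κ N n (n' - 1) j j') := bsSum_succ κ hN h1
  -- The recursion lowers the first index to `0` but need not exhaust the second, so its base case
  -- is the case of second index `0` with the arguments swapped by symmetry.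
  have h0 : ∀ n' j j', bsSum κ N n' 0 j j' = ampSum κ N n' 0 j j' := by
    intro n'
    induction n' with
    | zero =>
      intro j j'
      rw [bsSum_zero_zero κ hN h1, ampSum_zero_zero]
      rfl
    | succ n ih =>
      intro j j'
      rw [hrec, ampSum_succ, ih, ih]
  induction n generalizing n' j j' with
  | zero => rw [bsSum_symm, ampSum_symm, h0]
  | succ n ih => rw [hrec, ampSum_succ, ih, ih]

/-- The kernel of single-mode thermal loss in the number basis,
`⟨j| L(|n⟩⟨n'|) |j'⟩`. -/
def lossKernel (κ : unitInterval) (N : ℝ) (n n' j j' : ℕ) : ℝ :=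
  √((j.factorial : ℝ) / n.factorial) * √((j'.factorial : ℝ) / n'.factorial) * bsSum κ N n n' j j'

/-- A single-mode Kraus family `A n m j k = ⟨j| K_{m,k} |n⟩` conserving `n + m = j + k`, whose
channel is trace preserving with kernel `S`. -/
structure IsKrausFamily (A S : ℕ → ℕ → ℕ → ℕ → ℝ) : Prop where
  supp : ∀ n m j k, n + m ≠ j + k → A n m j k = 0
  hasSum : ∀ n n' j j', HasSum (fun e : ℕ × ℕ => A n e.1 j e.2 * A n' e.1 j' e.2) (S n n' j j')
  trace : ∀ n, HasSum (fun j => S n n j j) 1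

/-- Kraus amplitudes of thermal loss from the beam splitter. -/
def bsKraus (κ : unitInterval) (N : ℝ) (n m j k : ℕ) : ℝ :=
  √(thermalProb N m) * bsAmp κ n m j k

/-- Kraus amplitudes of loss followed by amplification. -/
def ampKraus (κ N : ℝ) (n a j l : ℕ) : ℝ :=
  √((j.factorial : ℝ) / n.factorial) * √(ampWeight κ N a l) * ampCoeff κ N n a j l

lemma lossParam_nonneg (hN : 0 ≤ N) (κ : unitInterval) : 0 ≤ lossParam κ N :=
  div_nonneg (mul_nonneg (sub_nonneg.mpr κ.2.2) (by positivity)) (gain_pos hN κ).le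

lemma ampParam_nonneg (hN : 0 ≤ N) (κ : unitInterval) : 0 ≤ ampParam κ N :=
  div_nonneg (mul_nonneg (sub_nonneg.mpr κ.2.2) hN) (gain_pos hN κ).le

lemma ampWeight_nonneg (hN : 0 ≤ N) (κ : unitInterval) (a l : ℕ) : 0 ≤ ampWeight κ N a l := by
  have h1 := lossParam_nonneg hN κ
  have h2 := ampParam_nonneg hN κ
  have h3 := gain_pos hN κ
  unfold ampWeight
  positivity

lemma ampParam_mul_lt_one (hN : 0 ≤ N) (κ : unitInterval) {x : ℝ} (hx0 : 0 ≤ x) (hx1 : x ≤ 1) :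
    0 ≤ ampParam κ N * x ∧ ampParam κ N * x < 1 := by
  have hlt : ampParam κ N < 1 := by
    rw [ampParam, div_lt_one (gain_pos hN κ), gain]; linarith
  have h0 := ampParam_nonneg hN κ
  exact ⟨by positivity, by nlinarith⟩

/-- The generating function of the output photon number of thermal loss on `|n⟩⟨n|`. -/
lemma hasSum_lossKernel_mul_pow (hN : 0 ≤ N) (h1 : (κ : ℝ) < 1) {x : ℝ} (hx0 : 0 ≤ x)
    (hx1 : x ≤ 1) (n : ℕ) :
    HasSum (fun j => lossKernel κ N n n j j * x ^ j)
      ((1 + (1 - κ) * N * (1 - x))⁻¹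
        * (1 + (x - 1) * κ / (1 + (1 - κ) * N * (1 - x))) ^ n) := by
  have hG := gain_pos hN κ
  have hG0 := hG.ne'
  obtain ⟨hv0, hv1⟩ := ampParam_mul_lt_one hN κ hx0 hx1
  set v := ampParam κ N with hv
  set w := lossParam κ N with hw
  set g := √(κ : ℝ) / gain κ N with hg
  have hg2 : g ^ 2 = κ / gain κ N ^ 2 := by rw [hg, div_pow, Real.sq_sqrt κ.2.1]
  have hvx : 0 < 1 - v * x := by linarith
  have hD : gain κ N * (1 - v * x) = 1 + (1 - κ) * N * (1 - x) := by
    rw [hv, ampParam, mul_sub, ← mul_assoc, mul_div_cancel₀ _ hG0, gain]; ring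
  have hD0 : 1 + (1 - (κ : ℝ)) * N * (1 - x) ≠ 0 := by rw [← hD]; positivity
  -- For a fixed number `l` of lost photons, the `p = n - l` survivors are amplified and the sum
  -- over added photons is a negative binomial series in `v x`.
  have hl : ∀ l ∈ Finset.range (n + 1), HasSum
      (fun j => (j.factorial / n.factorial : ℝ) * ampTerm κ N n n j j (j + l - n, l) * x ^ j)
      ((gain κ N * (1 - v * x))⁻¹ * (w ^ l * (g ^ 2 * x / (1 - v * x)) ^ (n - l) * n.choose l)) := by
    intro l hl
    obtain ⟨p, rfl⟩ : ∃ p, n = l + p := Nat.exists_eq_add_of_le (by simpa [Nat.lt_succ_iff] using hl)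
    have hgeom := (hasSum_choose_mul_geometric_of_norm_lt_one p
      (r := v * x) (by rwa [Real.norm_eq_abs, abs_of_nonneg hv0])).mul_left
      ((gain κ N)⁻¹ * w ^ l * (g ^ 2 * x) ^ p * (l + p).choose l)
    have hinj : Function.Injective fun a : ℕ => a + p := add_left_injective p
    refine (hinj.hasSum_iff ?_).mp (hasSum_of_eq hgeom ?_ ?_)
    · intro j hj
      have : j < p := by
        by_contra hle
        exact hj ⟨j - p, by simp; omega⟩
      have h2 : ¬ (l + p + (j + l - (l + p)) = j + l) := by omega
      simp [ampTerm, ampCoeff, h2]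
    · intro a
      have e1 : a + p + l - (l + p) = a := by omega
      have e2 : l + p + a = a + p + l := by omega
      have e3 : l + p - l = p := by omega
      simp only [Function.comp_apply, ampTerm, ampCoeff, e1, e2, e3, if_true, ampWeight, ← hv, ← hw,
        ← hg]
      have c1 : ((l + p).descFactorial l : ℝ) = (l + p).factorial / p.factorial := by
        have := Nat.factorial_mul_descFactorial (Nat.le_add_right l p)
        rw [Nat.add_sub_cancel_left] at this
        rw [eq_div_iff (by positivity), mul_comm]; exact_mod_cast this
      have c2 : ((l + p).choose l : ℝ) = (l + p).factorial / (l.factorial * p.factorial) := by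
        have := Nat.choose_mul_factorial_mul_factorial (Nat.le_add_right l p)
        rw [Nat.add_sub_cancel_left] at this
        rw [eq_div_iff (by positivity), ← mul_assoc]; exact_mod_cast this
      have c3 : ((a + p).choose p : ℝ) = (a + p).factorial / (a.factorial * p.factorial) := by
        have := Nat.choose_mul_factorial_mul_factorial (Nat.le_add_left p a)
        rw [Nat.add_sub_cancel] at this
        rw [eq_div_iff (by positivity), mul_comm (a.factorial : ℝ), ← mul_assoc]
        exact_mod_cast this
      rw [c1, c2, c3, pow_add x]
      field_simp
      ring
    · rw [Nat.add_sub_cancel_left, div_pow, pow_succ]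
      field_simp
      ring
  have hsum := hasSum_sum hl
  refine hasSum_of_eq hsum (fun j => ?_) ?_
  · rw [← Finset.sum_mul, ← Finset.mul_sum, ← (hasSum_ampTerm_of_range κ N n n j j).tsum_eq,
      lossKernel, Real.mul_self_sqrt (by positivity), bsSum_eq_ampSum hN h1]
    rfl
  -- The remaining sum over `l` is a binomial expansion of `(w + g² x / (1 - v x))ⁿ`.
  · rw [← Finset.mul_sum, ← add_pow, hD]
    congr 2
    have hw2 : w * gain κ N = (1 - κ) * (N + 1) := div_mul_cancel₀ _ hG0
    have e : g ^ 2 * x / (1 - v * x) = κ * x / (gain κ N * (1 + (1 - κ) * N * (1 - x))) := by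
      rw [hg2, ← hD]; field_simp
    rw [e]
    field_simp
    have hGe : gain κ N = 1 + (1 - κ) * N := rfl
    linear_combination (1 + (1 - (κ : ℝ)) * N * (1 - x) + (x - 1) * κ) * hGe
      - (1 + (1 - (κ : ℝ)) * N * (1 - x)) * hw2

lemma hasSum_lossKernel (hN : 0 ≤ N) (h1 : (κ : ℝ) < 1) (n : ℕ) :
    HasSum (fun j => lossKernel κ N n n j j) 1 := by
  simpa using hasSum_lossKernel_mul_pow hN h1 zero_le_one le_rfl n

lemma isKrausFamily_bsKraus (hN : 0 ≤ N) (h1 : (κ : ℝ) < 1) :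
    IsKrausFamily (bsKraus κ N) (lossKernel κ N) where
  supp n m j k h := by simp [bsKraus, bsAmp_eq, bsCoeff_eq_zero κ h]
  hasSum n n' j j' := by
    refine hasSum_of_eq ((hasSum_bsTerm κ hN n n' j j').mul_left
      (√((j.factorial : ℝ) / n.factorial) * √((j'.factorial : ℝ) / n'.factorial))) ?_ rfl
    rintro ⟨m, k⟩
    have hs : ∀ j n : ℕ, √((j.factorial * k.factorial : ℝ) / (n.factorial * m.factorial))
        = √((j.factorial : ℝ) / n.factorial) * √((k.factorial : ℝ) / m.factorial) := by
      intro j n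
      rw [← Real.sqrt_mul (by positivity), div_mul_div_comm]
    have hp := Real.mul_self_sqrt (thermalProb_nonneg hN m)
    have h2 : √((k.factorial : ℝ) / m.factorial) * √((k.factorial : ℝ) / m.factorial)
        = (k.factorial : ℝ) / m.factorial := Real.mul_self_sqrt (by positivity)
    simp only [bsKraus, bsAmp_eq, hs, bsTerm]
    linear_combination (√((j.factorial : ℝ) / n.factorial) * √((j'.factorial : ℝ) / n'.factorial)
      * bsCoeff κ n m j k * bsCoeff κ n' m j' k)
      * (√((k.factorial : ℝ) / m.factorial) ^ 2 * hp + thermalProb N m * h2)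
  trace := hasSum_lossKernel hN h1

lemma isKrausFamily_ampKraus (hN : 0 ≤ N) (h1 : (κ : ℝ) < 1) :
    IsKrausFamily (ampKraus κ N) (lossKernel κ N) where
  supp n m j k h := by simp [ampKraus, ampCoeff, h]
  hasSum n n' j j' := by
    refine hasSum_of_eq ((hasSum_ampTerm κ N n n' j j').mul_left
      (√((j.factorial : ℝ) / n.factorial) * √((j'.factorial : ℝ) / n'.factorial))) ?_
      (by rw [lossKernel, bsSum_eq_ampSum hN h1])
    rintro ⟨m, k⟩
    have hq := Real.mul_self_sqrt (ampWeight_nonneg hN κ m k)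
    simp only [ampKraus, ampTerm]
    linear_combination (√((j.factorial : ℝ) / n.factorial) * √((j'.factorial : ℝ) / n'.factorial)
      * ampCoeff κ N n m j k * ampCoeff κ N n' m j' k) * hq
  trace := hasSum_lossKernel hN h1

lemma IsKrausFamily.nonneg {A S : ℕ → ℕ → ℕ → ℕ → ℝ} (h : IsKrausFamily A S) (n j : ℕ) :
    0 ≤ S n n j j :=
  (h.hasSum n n j j).nonneg fun _ => mul_self_nonneg _

end KernelIdentity

/-! ### Multi-mode channels from single-mode Kraus families -/

lemma hasSum_mul_prod {α β : Type*} {f : α → ℝ} {g : β → ℝ} {a b : ℝ} (hf : HasSum f a)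
    (hg : HasSum g b) : HasSum (fun x : α × β => f x.1 * g x.2) (a * b) :=
  hf.mul hg (summable_mul_of_summable_norm hf.summable.norm hg.summable.norm)

lemma hasSum_pi_prod {M : ℕ} {ι : Type*} {f : Fin M → ι → ℝ} {s : Fin M → ℝ}
    (h : ∀ i, HasSum (f i) (s i)) :
    HasSum (fun e : Fin M → ι => ∏ i, f i (e i)) (∏ i, s i) := by
  induction M with
  | zero => simp
  | succ M ih =>
    have hm := hasSum_mul_prod (h 0) (ih fun i => h i.succ)
    rw [Fin.prod_univ_succ]
    refine ((Fin.consEquiv fun _ : Fin (M + 1) => ι).hasSum_iff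
      (f := fun e : Fin (M + 1) → ι => ∏ i, f i (e i))).mp ?_
    convert hm using 2 with e
    simp [Fin.prod_univ_succ, Fin.consEquiv]

/-- Nonnegative double series are evaluated in `ℝ≥0∞`, where sums may be exchanged freely; this
brings the result back to `ℝ`. -/
lemma hasSum_of_tsum_ofReal {ι : Type*} {f : ι → ℝ} (hf : ∀ i, 0 ≤ f i) {c : ℝ} (hc : 0 ≤ c)
    (h : ∑' i, ENNReal.ofReal (f i) = ENNReal.ofReal c) : HasSum f c := by
  have h1 := ENNReal.hasSum_toReal (f := fun i => ENNReal.ofReal (f i))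
    (by rw [h]; exact ENNReal.ofReal_ne_top)
  rw [← ENNReal.tsum_toReal_eq (fun _ => ENNReal.ofReal_ne_top), h,
    ENNReal.toReal_ofReal hc] at h1
  exact hasSum_of_eq h1 (fun i => (ENNReal.toReal_ofReal (hf i)).symm) rfl

lemma tsum_ofReal_of_hasSum {ι : Type*} {f : ι → ℝ} (hf : ∀ i, 0 ≤ f i) {c : ℝ}
    (h : HasSum f c) : ∑' i, ENNReal.ofReal (f i) = ENNReal.ofReal c := by
  rw [← h.tsum_eq, ENNReal.ofReal_tsum_of_nonneg hf h.summable]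

lemma hasSum_norm_sq_modes {M : ℕ} {H : Type*} [NormedAddCommGroup H] (ψ : Modes M H) :
    HasSum (fun n => ‖ψ n‖ ^ 2) (‖ψ‖ ^ 2) := by
  simpa using lp.hasSum_norm (p := 2) (by norm_num) ψ

section MultiMode

open InnerProductSpace

variable {M : ℕ} {H : Type*} [NormedAddCommGroup H] [InnerProductSpace ℂ H]

/-- Multi-mode Kraus amplitudes. -/
def prodAmp (A : ℕ → ℕ → ℕ → ℕ → ℝ) (n : Fin M → ℕ) (e : (Fin M → ℕ) × (Fin M → ℕ))
    (j : Fin M → ℕ) : ℝ :=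
  ∏ i, A (n i) (e.1 i) (j i) (e.2 i)

/-- Multi-mode kernel. -/
def prodKernel (S : ℕ → ℕ → ℕ → ℕ → ℝ) (n n' j j' : Fin M → ℕ) : ℝ :=
  ∏ i, S (n i) (n' i) (j i) (j' i)

/-- The components of the Kraus operator with index `e` applied to `ψ`. -/
def multiKrausFun (A : ℕ → ℕ → ℕ → ℕ → ℝ) (e : (Fin M → ℕ) × (Fin M → ℕ))
    (ψ : (Fin M → ℕ) → H) (j : Fin M → ℕ) : H :=
  ((prodAmp A (j + e.2 - e.1) e j : ℝ) : ℂ) • ψ (j + e.2 - e.1)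

variable {A S : ℕ → ℕ → ℕ → ℕ → ℝ}

namespace IsKrausFamily

lemma prodAmp_eq_zero (h : IsKrausFamily A S) {n : Fin M → ℕ}
    {e : (Fin M → ℕ) × (Fin M → ℕ)} {j : Fin M → ℕ} (hne : n + e.1 ≠ j + e.2) :
    prodAmp A n e j = 0 := by
  obtain ⟨i, hi⟩ := Function.ne_iff.mp hne
  exact Finset.prod_eq_zero (Finset.mem_univ i) (h.supp _ _ _ _ hi)

lemma prodAmp_eq_zero_of_ne_sub (h : IsKrausFamily A S) {n : Fin M → ℕ}
    {e : (Fin M → ℕ) × (Fin M → ℕ)} {j : Fin M → ℕ} (hne : n ≠ j + e.2 - e.1) :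
    prodAmp A n e j = 0 :=
  h.prodAmp_eq_zero fun h' => hne (by rw [← h', add_tsub_cancel_right])

lemma hasSum_prodAmp (h : IsKrausFamily A S) (n n' j j' : Fin M → ℕ) :
    HasSum (fun e => prodAmp A n e j * prodAmp A n' e j') (prodKernel S n n' j j') := by
  rw [← (Equiv.arrowProdEquivProdArrow (Fin M) (fun _ => ℕ) (fun _ => ℕ)).hasSum_iff]
  refine hasSum_of_eq (hasSum_pi_prod fun i => h.hasSum (n i) (n' i) (j i) (j' i)) (fun e => ?_) rfl
  simp [prodAmp, Equiv.arrowProdEquivProdArrow, Finset.prod_mul_distrib]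

lemma prodKernel_nonneg (h : IsKrausFamily A S) (n j : Fin M → ℕ) :
    0 ≤ prodKernel S n n j j :=
  Finset.prod_nonneg fun _ _ => h.nonneg _ _

lemma hasSum_prodKernel (h : IsKrausFamily A S) (n : Fin M → ℕ) :
    HasSum (fun j => prodKernel S n n j j) 1 := by
  exact hasSum_of_eq (hasSum_pi_prod fun i : Fin M => h.trace (n i)) (fun _ => rfl) (by simp)

/-- For a given Kraus index and output `j`, only one input number state contributes, so the squared
norm has no cross terms and only the diagonal of the kernel appears. -/
lemma tsum_norm_sq_multiKrausFun (h : IsKrausFamily A S) (ψ : (Fin M → ℕ) → H)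
    (j : Fin M → ℕ) :
    ∑' e, ENNReal.ofReal (‖multiKrausFun A e ψ j‖ ^ 2)
      = ∑' n, ENNReal.ofReal (prodKernel S n n j j) * ENNReal.ofReal (‖ψ n‖ ^ 2) := by
  have h1 : ∀ e : (Fin M → ℕ) × (Fin M → ℕ), ENNReal.ofReal (‖multiKrausFun A e ψ j‖ ^ 2)
      = ∑' n, ENNReal.ofReal (prodAmp A n e j * prodAmp A n e j) * ENNReal.ofReal (‖ψ n‖ ^ 2) := by
    intro e
    rw [tsum_eq_single (j + e.2 - e.1) fun n hn => by simp [h.prodAmp_eq_zero_of_ne_sub hn],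
      ← ENNReal.ofReal_mul (mul_self_nonneg _), multiKrausFun, norm_smul, mul_pow,
      Complex.norm_real, Real.norm_eq_abs, sq_abs, sq (prodAmp _ _ _ _)]
  simp_rw [h1]
  rw [ENNReal.tsum_comm]
  refine tsum_congr fun n => ?_
  rw [ENNReal.tsum_mul_right, tsum_ofReal_of_hasSum (fun _ => mul_self_nonneg _)
    (h.hasSum_prodAmp n n j j)]

lemma tsum_tsum_norm_sq_multiKrausFun (h : IsKrausFamily A S) (ψ : Modes M H) :
    ∑' e, ∑' j, ENNReal.ofReal (‖multiKrausFun A e ψ j‖ ^ 2) = ENNReal.ofReal (‖ψ‖ ^ 2) := by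
  rw [ENNReal.tsum_comm]
  simp_rw [h.tsum_norm_sq_multiKrausFun]
  rw [ENNReal.tsum_comm, ← tsum_ofReal_of_hasSum (fun _ => by positivity) (hasSum_norm_sq_modes ψ)]
  refine tsum_congr fun n => ?_
  rw [ENNReal.tsum_mul_right, tsum_ofReal_of_hasSum (h.prodKernel_nonneg n)
    (h.hasSum_prodKernel n), ENNReal.ofReal_one, one_mul]

lemma memℓp_multiKrausFun (h : IsKrausFamily A S) (e : (Fin M → ℕ) × (Fin M → ℕ))
    (ψ : Modes M H) : Memℓp (multiKrausFun A e ψ) 2 := by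
  refine memℓp_gen ?_
  have hne : ∑' j, ENNReal.ofReal (‖multiKrausFun A e ψ j‖ ^ 2) ≠ ⊤ := by
    refine ne_top_of_le_ne_top ?_ (ENNReal.le_tsum
      (f := fun e => ∑' j, ENNReal.ofReal (‖multiKrausFun A e ψ j‖ ^ 2)) e)
    rw [h.tsum_tsum_norm_sq_multiKrausFun]
    exact ENNReal.ofReal_ne_top
  have := (ENNReal.hasSum_toReal hne).summable
  refine this.congr fun j => ?_
  rw [ENNReal.toReal_ofReal (by positivity)]
  simp

/-- The Kraus operator with index `e` applied to `ψ`. -/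
def vec (h : IsKrausFamily A S) (ψ : Modes M H) (e : (Fin M → ℕ) × (Fin M → ℕ)) : Modes M H :=
  ⟨multiKrausFun A e ψ, h.memℓp_multiKrausFun e ψ⟩

lemma vec_apply (h : IsKrausFamily A S) (ψ : Modes M H) (e : (Fin M → ℕ) × (Fin M → ℕ))
    (j : Fin M → ℕ) : h.vec ψ e j = multiKrausFun A e ψ j := rfl

lemma tsum_norm_sq_vec (h : IsKrausFamily A S) (ψ : Modes M H) :
    ∑' e, ENNReal.ofReal (‖h.vec ψ e‖ ^ 2) = ENNReal.ofReal (‖ψ‖ ^ 2) := by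
  rw [← h.tsum_tsum_norm_sq_multiKrausFun]
  exact tsum_congr fun e =>
    (tsum_ofReal_of_hasSum (fun _ => by positivity) (hasSum_norm_sq_modes (h.vec ψ e))).symm

lemma hasSum_norm_sq_vec (h : IsKrausFamily A S) (ψ : Modes M H) :
    HasSum (fun e => ‖h.vec ψ e‖ ^ 2) (‖ψ‖ ^ 2) :=
  hasSum_of_tsum_ofReal (fun _ => by positivity) (by positivity) (h.tsum_norm_sq_vec ψ)

lemma summable_rankOne_vec [CompleteSpace H] (h : IsKrausFamily A S) (ψ : Modes M H) :
    Summable fun e => rankOne ℂ (h.vec ψ e) (h.vec ψ e) := by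
  refine Summable.of_norm ((h.hasSum_norm_sq_vec ψ).summable.congr fun e => ?_)
  rw [norm_rankOne, sq]

lemma tsum_inner_mul_inner_multiKrausFun (h : IsKrausFamily A S) (ψ : (Fin M → ℕ) → H)
    (x y : H) (j j' : Fin M → ℕ)
    (hs : Summable fun e => ⟪x, multiKrausFun A e ψ j⟫_ℂ * ⟪multiKrausFun A e ψ j', y⟫_ℂ) :
    ∑' e, ⟪x, multiKrausFun A e ψ j⟫_ℂ * ⟪multiKrausFun A e ψ j', y⟫_ℂ
      = ∑' q : (Fin M → ℕ) × (Fin M → ℕ),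
          ((prodKernel S q.1 q.2 j j' : ℝ) : ℂ) * (⟪x, ψ q.1⟫_ℂ * ⟪ψ q.2, y⟫_ℂ) := by
  -- The two inputs determined by `e` are promoted to free indices. The amplitudes vanish off the
  -- graph of `g`, so summability carries over and the sum over `e` can be taken first, producing
  -- the kernel.
  set F : ((Fin M → ℕ) × (Fin M → ℕ)) × ((Fin M → ℕ) × (Fin M → ℕ)) → ℂ := fun z =>
    ((prodAmp A z.2.1 z.1 j * prodAmp A z.2.2 z.1 j' : ℝ) : ℂ) * (⟪x, ψ z.2.1⟫_ℂ * ⟪ψ z.2.2, y⟫_ℂ)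
    with hF
  set g : (Fin M → ℕ) × (Fin M → ℕ) → ((Fin M → ℕ) × (Fin M → ℕ)) × ((Fin M → ℕ) × (Fin M → ℕ)) :=
    fun e => (e, (j + e.2 - e.1, j' + e.2 - e.1)) with hg
  have hinj : Function.Injective g := fun a b hab => (Prod.ext_iff.mp hab).1
  have hFg : (fun e => ⟪x, multiKrausFun A e ψ j⟫_ℂ * ⟪multiKrausFun A e ψ j', y⟫_ℂ) = F ∘ g := by
    funext e
    simp only [hF, hg, multiKrausFun, Function.comp_apply, inner_smul_left, inner_smul_right,
      Complex.conj_ofReal]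
    push_cast
    ring
  have hzero : ∀ z ∉ Set.range g, F z = 0 := by
    rintro ⟨e, n, n'⟩ hz
    by_cases h1 : n = j + e.2 - e.1
    · have h2 : n' ≠ j' + e.2 - e.1 := fun h2 => hz ⟨e, by simp only [hg, h1, h2]⟩
      simp [hF, h.prodAmp_eq_zero_of_ne_sub h2]
    · simp [hF, h.prodAmp_eq_zero_of_ne_sub h1]
  rw [hFg] at hs ⊢
  have hsF : Summable F := (hinj.summable_iff hzero).mp hs
  have h1 : ∑' e, (F ∘ g) e = ∑' z, F z :=
    ((hinj.hasSum_iff hzero).mpr hsF.hasSum).tsum_eq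
  rw [h1, hsF.tsum_prod, ← Summable.tsum_comm (f := fun e q => F (e, q)) hsF]
  refine tsum_congr fun q => ?_
  simp only [hF]
  rw [tsum_mul_right]
  congr 1
  exact (Complex.hasSum_ofReal.mpr (h.hasSum_prodAmp q.1 q.2 j j')).tsum_eq

end IsKrausFamily

lemma inner_apply_single_eq_tsum {E : Type*} {v : E → Modes M H} {T : Modes M H →L[ℂ] Modes M H}
    (hT : HasSum (fun e => rankOne ℂ (v e) (v e)) T) (x y : H) (j j' : Fin M → ℕ) :
    HasSum (fun e => ⟪x, v e j⟫_ℂ * ⟪v e j', y⟫_ℂ)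
      ⟪x, T (lp.singleContinuousLinearMap ℂ (fun _ : Fin M → ℕ => H) 2 j' y) j⟫_ℂ := by
  classical
  have h := (hT.mapL (ContinuousLinearMap.apply ℂ (Modes M H)
    (lp.singleContinuousLinearMap ℂ (fun _ : Fin M → ℕ => H) 2 j' y))).mapL
    (innerSL ℂ x ∘L lp.evalCLM ℂ (fun _ : Fin M → ℕ => H) 2 j)
  refine hasSum_of_eq h (fun e => ?_) rfl
  have h2 : ⟪v e, lp.singleContinuousLinearMap ℂ (fun _ : Fin M → ℕ => H) 2 j' y⟫_ℂ
      = ⟪v e j', y⟫_ℂ := by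
    rw [lp.singleContinuousLinearMap_apply]
    exact lp.inner_single_right (𝕜 := ℂ) j' y (v e)
  change _ = ⟪x, (⟪v e, lp.singleContinuousLinearMap ℂ (fun _ : Fin M → ℕ => H) 2 j' y⟫_ℂ
    • v e j)⟫_ℂ
  rw [h2, inner_smul_right, mul_comm]

/-- Two Kraus families with the same kernel define the same channel. -/
lemma IsKrausFamily.tsum_rankOne_vec_eq {B : ℕ → ℕ → ℕ → ℕ → ℝ} [CompleteSpace H]
    (hA : IsKrausFamily A S) (hB : IsKrausFamily B S) (ψ : Modes M H) :
    ∑' e, rankOne ℂ (hA.vec ψ e) (hA.vec ψ e) = ∑' e, rankOne ℂ (hB.vec ψ e) (hB.vec ψ e) := by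
  -- Matrix elements between number states determine a bounded operator, and they depend on the
  -- Kraus family only through `S`.
  refine lp.ext_continuousLinearMap (by norm_num) fun j' => ?_
  ext y j
  refine ext_inner_left ℂ fun x => ?_
  have h1 := inner_apply_single_eq_tsum (hA.summable_rankOne_vec ψ).hasSum x y j j'
  have h2 := inner_apply_single_eq_tsum (hB.summable_rankOne_vec ψ).hasSum x y j j'
  have h3 := hA.tsum_inner_mul_inner_multiKrausFun ψ x y j j' h1.summable
  have h4 := hB.tsum_inner_mul_inner_multiKrausFun ψ x y j j' h2.summable
  exact (h1.tsum_eq.symm.trans h3).trans (h4.symm.trans h2.tsum_eq)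

end MultiMode

/-! ### The thermal loss channel as a Kraus family -/

section ThermalLoss

open InnerProductSpace

variable {M : ℕ} {H : Type*} [NormedAddCommGroup H] [InnerProductSpace ℂ H]
  {κ : unitInterval} {N : ℝ}

lemma thermalPMF_eq_prod (N : ℝ) (n : Fin M → ℕ) : thermalPMF N n = ∏ i, thermalProb N (n i) := rfl

lemma thermalPMF_nonneg (hN : 0 ≤ N) (n : Fin M → ℕ) : 0 ≤ thermalPMF N n :=
  Finset.prod_nonneg fun _ _ => thermalProb_nonneg hN _

lemma hasSum_thermalPMF (hN : 0 ≤ N) : HasSum (thermalPMF (M := M) N) 1 := by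
  exact hasSum_of_eq (hasSum_pi_prod fun _ : Fin M => hasSum_thermalProb hN) (fun _ => rfl)
    (by simp)

lemma bsKraus_vec_eq (hN : 0 ≤ N) (h1 : (κ : ℝ) < 1) (ψ : Modes M H)
    (e : (Fin M → ℕ) × (Fin M → ℕ)) :
    (isKrausFamily_bsKraus hN h1).vec ψ e
      = ((√(thermalPMF N e.1) : ℝ) : ℂ) • kraus κ e.1 e.2 ψ := by
  ext j
  change multiKrausFun (bsKraus κ N) e ψ j
    = ((√(thermalPMF N e.1) : ℝ) : ℂ) • krausFun κ e.1 e.2 ψ j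
  have hprod : prodAmp (bsKraus κ N) (j + e.2 - e.1) e j = √(thermalPMF N e.1)
      * ∏ i, bsAmp κ ((j + e.2 - e.1) i) (e.1 i) (j i) (e.2 i) := by
    rw [thermalPMF_eq_prod, Real.sqrt_prod _ fun i _ => thermalProb_nonneg hN _,
      ← Finset.prod_mul_distrib]
    rfl
  by_cases hle : e.1 ≤ j + e.2
  · rw [krausFun, if_pos hle, multiKrausFun, hprod, smul_smul]
    push_cast
    rfl
  · rw [krausFun, if_neg hle, multiKrausFun, (isKrausFamily_bsKraus hN h1).prodAmp_eq_zero]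
    · simp
    · exact fun h => hle (h ▸ le_add_self)

variable [CompleteSpace H]

lemma smul_comp_rankOne_comp_adjoint {p : ℝ} (hp : 0 ≤ p) (K : H →L[ℂ] H) (ψ : H) :
    ((p : ℝ) : ℂ) • (K ∘L rankOne ℂ ψ ψ ∘L ContinuousLinearMap.adjoint K)
      = rankOne ℂ (((√p : ℝ) : ℂ) • K ψ) (((√p : ℝ) : ℂ) • K ψ) := by
  ext x
  have hpp : ((√p : ℝ) : ℂ) * ((√p : ℝ) : ℂ) = p := by
    rw [← Complex.ofReal_mul, Real.mul_self_sqrt hp]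
  simp only [smul_apply, ContinuousLinearMap.comp_apply, rankOne_apply, map_smul,
    ContinuousLinearMap.adjoint_inner_right, inner_smul_left, Complex.conj_ofReal, smul_smul]
  rw [← hpp]
  congr 1
  ring

lemma thermalLoss_term_eq (hN : 0 ≤ N) (h1 : (κ : ℝ) < 1) (ψ : Modes M H)
    (e : (Fin M → ℕ) × (Fin M → ℕ)) :
    ((thermalPMF N e.1 : ℝ) : ℂ) • (kraus κ e.1 e.2 ∘L rankOne ℂ ψ ψ
        ∘L ContinuousLinearMap.adjoint (kraus κ e.1 e.2))
      = rankOne ℂ ((isKrausFamily_bsKraus hN h1).vec ψ e)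
          ((isKrausFamily_bsKraus hN h1).vec ψ e) := by
  rw [smul_comp_rankOne_comp_adjoint (thermalPMF_nonneg hN _), bsKraus_vec_eq hN h1]

/-- Thermal loss of a pure state, as a mixture over lost and added photons. -/
lemma hasSum_thermalLoss_rankOne (hN : 0 ≤ N) (h1 : (κ : ℝ) < 1) (ψ : Modes M H) :
    HasSum (fun e => rankOne ℂ ((isKrausFamily_ampKraus hN h1).vec ψ e)
      ((isKrausFamily_ampKraus hN h1).vec ψ e)) (thermalLoss κ N (rankOne ℂ ψ ψ)) := by
  rw [thermalLoss]
  simp_rw [thermalLoss_term_eq hN h1]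
  rw [(isKrausFamily_bsKraus hN h1).tsum_rankOne_vec_eq (isKrausFamily_ampKraus hN h1)]
  exact ((isKrausFamily_ampKraus hN h1).summable_rankOne_vec ψ).hasSum

end ThermalLoss

/-! ### Overlap of purifications of Alice's states -/

section Overlap

variable {η : unitInterval} {N : ℝ}

lemma Theta_eq_sqrt_lossParam (hN : 0 ≤ N) (η : unitInterval) :
    Theta η N = √(lossParam η N) := by
  rw [Theta, lossParam, gain, Real.sqrt_div]
  exact mul_nonneg (sub_nonneg.mpr η.2.2) (by positivity)

lemma lossParam_le_one (hN : 0 ≤ N) (η : unitInterval) : lossParam η N ≤ 1 := by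
  rw [lossParam, div_le_one (gain_pos hN η), gain]
  have := η.2.1
  linarith

lemma Theta_nonneg (η N : ℝ) : 0 ≤ Theta η N := by unfold Theta; positivity

lemma Theta_le_one (hN : 0 ≤ N) (η : unitInterval) : Theta η N ≤ 1 := by
  rw [Theta_eq_sqrt_lossParam hN]
  exact Real.sqrt_le_one.mpr (lossParam_le_one hN η)

/-- When all `l` input photons are lost and `a` are added, no transmission factor is left and the
amplitude factors. The `a` part is the square root of the thermal probability with mean `(1 - η) N`,
and each lost photon contributes `Θ`. -/
lemma ampKraus_diag (hN : 0 ≤ N) (η : unitInterval) (a l : ℕ) :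
    ampKraus η N l a a l = √(ampParam η N ^ a / gain η N) * Theta η N ^ l := by
  have hG := gain_pos hN η
  have hw := lossParam_nonneg hN η
  have hv := ampParam_nonneg hN η
  have e1 : (a.factorial / l.factorial : ℝ) * ampWeight η N a l * (l.factorial : ℝ) ^ 2
      = ampParam η N ^ a / gain η N * lossParam η N ^ l := by
    rw [ampWeight]; field_simp
  have e2 : ∀ b : ℝ, 0 ≤ b → √b * l.factorial = √(b * (l.factorial : ℝ) ^ 2) := fun b hb => by
    rw [Real.sqrt_mul hb, Real.sqrt_sq (by positivity)]
  rw [ampKraus, ampCoeff, if_pos (add_comm l a), Nat.descFactorial_self, Nat.sub_self, pow_zero,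
    mul_one, Theta_eq_sqrt_lossParam hN, ← Real.sqrt_mul (by positivity)]
  rw [e2 _ (mul_nonneg (by positivity) (ampWeight_nonneg hN η a l)), e1,
    Real.sqrt_mul (by positivity)]
  congr 1
  rw [Real.sqrt_eq_iff_mul_self_eq (by positivity) (by positivity), ← mul_pow,
    Real.mul_self_sqrt hw]

/-- `ν` is the Bhattacharyya overlap of the thermal distributions with means `N` and `(1 - η) N`, a
geometric series. -/
lemma hasSum_nu (hN : 0 ≤ N) :
    HasSum (fun a : ℕ => √(thermalProb N a) * √(ampParam η N ^ a / gain η N)) (nu η N) := by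
  have hG := gain_pos hN η
  have hv := ampParam_nonneg hN η
  have hv1 : ampParam η N < 1 := by
    simpa using (ampParam_mul_lt_one hN η zero_le_one le_rfl).2
  have hl0 : 0 ≤ N / (N + 1) := by positivity
  have hl1 : N / (N + 1) < 1 := by rw [div_lt_one (by positivity)]; linarith
  have hlt : √(N / (N + 1) * ampParam η N) < 1 := by
    rw [Real.sqrt_lt' one_pos, one_pow]
    nlinarith
  have hgeo := (hasSum_geometric_of_lt_one (Real.sqrt_nonneg _) hlt).mul_left
    (√((N + 1) * gain η N))⁻¹
  refine hasSum_of_eq hgeo (fun a => ?_) ?_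
  · rw [thermalProb_eq hN, ← Real.sqrt_mul (by positivity), ← Real.sqrt_inv]
    have : (N + 1)⁻¹ * (N / (N + 1)) ^ a * (ampParam η N ^ a / gain η N)
        = ((N + 1) * gain η N)⁻¹ * (N / (N + 1) * ampParam η N) ^ a := by
      rw [mul_pow, mul_inv]; ring
    rw [this, Real.sqrt_mul (by positivity)]
    congr 1
    rw [Real.sqrt_eq_iff_mul_self_eq (by positivity) (by positivity), ← mul_pow,
      Real.mul_self_sqrt (by positivity)]
  · have hG' : (1 - (η : ℝ)) * N + 1 = gain η N := by rw [gain]; ring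
    have e : N / (N + 1) * ampParam η N
        = (N + 1 - 1) * (gain η N - 1) / ((N + 1) * gain η N) := by
      rw [ampParam, gain]; field_simp; ring
    have hpos : 0 < √((N + 1) * gain η N) := Real.sqrt_pos.mpr (by positivity)
    rw [nu, hG', e, Real.sqrt_div' _ (by positivity), ← mul_inv]
    congr 1
    field_simp

end Overlap

/-! ### Alice's two mixtures and their overlap -/

section Alice

open InnerProductSpace

variable {M : ℕ} {I : Type*} [NormedAddCommGroup I] [InnerProductSpace ℂ I]

/-- `x ⊗ |a⟩`. -/
def inMode (a : Fin M → ℕ) (x : I) : Modes M I :=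
  lp.singleContinuousLinearMap ℂ (fun _ : Fin M → ℕ => I) 2 a x

lemma inner_inMode_left (a : Fin M → ℕ) (x : I) (φ : Modes M I) :
    ⟪inMode a x, φ⟫_ℂ = ⟪x, φ a⟫_ℂ := by
  classical
  rw [inMode, lp.singleContinuousLinearMap_apply]
  exact lp.inner_single_left (𝕜 := ℂ) a x φ

lemma norm_inMode (a : Fin M → ℕ) (x : I) : ‖inMode a x‖ = ‖x‖ := by
  classical
  rw [inMode, lp.singleContinuousLinearMap_apply]
  exact lp.norm_single (E := fun _ : Fin M → ℕ => I) (p := 2) (by norm_num) a x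

lemma inMode_apply_self (a : Fin M → ℕ) (x : I) : inMode a x a = x := by
  classical
  rw [inMode, lp.singleContinuousLinearMap_apply, lp.single_apply_self]

namespace Probe

variable (P : Probe M I)

lemma norm_sq_ket_apply (n : Fin M → ℕ) : ‖P.ket n‖ ^ 2 = P.p n := by
  change ‖((√(P.p n) : ℝ) : ℂ) • P.χ n‖ ^ 2 = _
  rw [norm_smul, P.χ_norm, mul_one, Complex.norm_real, Real.norm_eq_abs, sq_abs,
    Real.sq_sqrt (P.p_nonneg n)]

lemma norm_sq_ket : ‖P.ket‖ ^ 2 = 1 :=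
  (hasSum_norm_sq_modes P.ket).unique
    (hasSum_of_eq P.p_sum (fun n => P.norm_sq_ket_apply n) rfl)

/-- The vectors of a purification of Alice's state without target. -/
def absentVec (N : ℝ) (e : (Fin M → ℕ) × (Fin M → ℕ)) : Modes M I :=
  ((√(thermalPMF N e.1) : ℝ) : ℂ) • inMode e.1 (P.ket e.2)

variable {N : ℝ}

lemma hasSum_norm_sq_absentVec (hN : 0 ≤ N) : HasSum (fun e => ‖P.absentVec N e‖ ^ 2) 1 := by
  refine hasSum_of_eq (hasSum_mul_prod (hasSum_thermalPMF hN) P.p_sum) (fun e => ?_) (by simp)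
  rw [absentVec, norm_smul, norm_inMode, mul_pow, P.norm_sq_ket_apply, Complex.norm_real,
    Real.norm_eq_abs, sq_abs, Real.sq_sqrt (thermalPMF_nonneg hN _)]

/-- At label `(a, l)` the absent vector lives on `|a⟩`, and conservation makes the present vector's
component there a multiple of the probe component `ψ_l`. The inner product is thus diagonal in the
probe, needs no orthogonality of the `χₙ`, and splits into an `a` sum and an `l` sum. -/
lemma hasSum_overlap {η : unitInterval} (hN : 0 ≤ N) (h1 : (η : ℝ) < 1) :
    HasSum (fun e => RCLike.re ⟪P.absentVec N e,
        (isKrausFamily_ampKraus hN h1).vec P.ket e⟫_ℂ)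
      (nu η N ^ M * ∑' n, P.p n * ∏ i, Theta η N ^ n i) := by
  have hs : Summable fun n => P.p n * ∏ i, Theta η N ^ n i := by
    refine P.p_sum.summable.of_nonneg_of_le
      (fun n => mul_nonneg (P.p_nonneg n) (Finset.prod_nonneg fun i _ => ?_))
      (fun n => mul_le_of_le_one_right (P.p_nonneg n) (Finset.prod_le_one (fun i _ => ?_)
        fun i _ => pow_le_one₀ (Theta_nonneg _ _) (Theta_le_one hN η)))
    all_goals exact pow_nonneg (Theta_nonneg _ _) _
  refine hasSum_of_eq (hasSum_mul_prod (hasSum_pi_prod fun _ : Fin M => hasSum_nu (η := η) hN)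
    hs.hasSum) (fun e => ?_) (by simp)
  obtain ⟨a, l⟩ := e
  rw [absentVec, inner_smul_left, inner_inMode_left, Complex.conj_ofReal,
    IsKrausFamily.vec_apply, multiKrausFun]
  simp only [add_tsub_cancel_left]
  have hamp : √(thermalPMF N a) * prodAmp (ampKraus η N) l (a, l) a
      = (∏ i, √(thermalProb N (a i)) * √(ampParam η N ^ a i / gain η N))
        * ∏ i, Theta η N ^ l i := by
    rw [thermalPMF_eq_prod, Real.sqrt_prod _ fun i _ => thermalProb_nonneg hN _, prodAmp,
      ← Finset.prod_mul_distrib, ← Finset.prod_mul_distrib]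
    exact Finset.prod_congr rfl fun i _ => by rw [ampKraus_diag hN, mul_assoc]
  have hreal : ((√(thermalPMF N a) : ℝ) : ℂ) * (((prodAmp (ampKraus η N) l (a, l) a : ℝ) : ℂ)
      * ⟪P.ket l, P.ket l⟫_ℂ)
      = ((√(thermalPMF N a) * prodAmp (ampKraus η N) l (a, l) a * P.p l : ℝ) : ℂ) := by
    rw [inner_self_eq_norm_sq_to_K, ← P.norm_sq_ket_apply]
    push_cast
    rw [mul_assoc]
    rfl
  rw [inner_smul_right, hreal, hamp]
  have hre : ∀ r : ℝ, RCLike.re (r : ℂ) = r := fun r => Complex.ofReal_re r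
  rw [hre]
  ring

variable [CompleteSpace I]

lemma hasSum_traceModes_density :
    HasSum (fun n => rankOne ℂ (P.ket n) (P.ket n)) (traceModes P.density) := by
  have hterm : ∀ n : Fin M → ℕ, lp.evalCLM ℂ (fun _ : Fin M → ℕ => I) 2 n ∘L P.density
      ∘L lp.singleContinuousLinearMap ℂ (fun _ : Fin M → ℕ => I) 2 n
      = rankOne ℂ (P.ket n) (P.ket n) := by
    intro n
    ext x
    change ⟪P.ket, inMode n x⟫_ℂ • P.ket n = ⟪P.ket n, x⟫_ℂ • P.ket n
    rw [← inner_conj_symm, inner_inMode_left, inner_conj_symm]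
  rw [traceModes]
  simp_rw [hterm]
  refine (Summable.of_norm (P.p_sum.summable.congr fun n => ?_)).hasSum
  rw [norm_rankOne, ← P.norm_sq_ket_apply, sq]

lemma hasSum_aliceAbsent (hN : 0 ≤ N) :
    HasSum (fun e => rankOne ℂ (P.absentVec N e) (P.absentVec N e)) (P.aliceAbsent N) := by
  have hs : Summable fun e => rankOne ℂ (P.absentVec N e) (P.absentVec N e) := by
    refine Summable.of_norm ((P.hasSum_norm_sq_absentVec hN).summable.congr fun e => ?_)
    rw [norm_rankOne, sq]
  have hfib : ∀ a : Fin M → ℕ, HasSum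
      (fun l => rankOne ℂ (P.absentVec N (a, l)) (P.absentVec N (a, l)))
      (((thermalPMF N a : ℝ) : ℂ) • (lp.singleContinuousLinearMap ℂ (fun _ : Fin M → ℕ => I) 2 a
        ∘L traceModes P.density ∘L lp.evalCLM ℂ (fun _ : Fin M → ℕ => I) 2 a)) := by
    intro a
    set L : (I →L[ℂ] I) →L[ℂ] (Modes M I →L[ℂ] Modes M I) :=
      (ContinuousLinearMap.compL ℂ (Modes M I) I (Modes M I)
        (lp.singleContinuousLinearMap ℂ (fun _ : Fin M → ℕ => I) 2 a)) ∘L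
      ((ContinuousLinearMap.compL ℂ (Modes M I) I I).flip
        (lp.evalCLM ℂ (fun _ : Fin M → ℕ => I) 2 a)) with hL
    refine hasSum_of_eq ((P.hasSum_traceModes_density.mapL L).const_smul
      ((thermalPMF N a : ℝ) : ℂ)) (fun l => ?_) rfl
    ext1 φ
    have hpp : ((√(thermalPMF N a) : ℝ) : ℂ) * ((√(thermalPMF N a) : ℝ) : ℂ)
        = (thermalPMF N a : ℂ) := by
      rw [← Complex.ofReal_mul, Real.mul_self_sqrt (thermalPMF_nonneg hN _)]
    change ⟪P.absentVec N (a, l), φ⟫_ℂ • P.absentVec N (a, l)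
      = (thermalPMF N a : ℂ) • inMode a (⟪P.ket l, φ a⟫_ℂ • P.ket l)
    rw [absentVec, inner_smul_left, inner_inMode_left, Complex.conj_ofReal, smul_smul, inMode,
      inMode, map_smul, smul_smul, ← hpp]
    congr 1
    ring
  have := hs.hasSum.prod_fiberwise hfib
  rw [aliceAbsent, tensorThermal, this.tsum_eq]
  exact hs.hasSum

/-- Alice's error probability is bounded below in terms of the photon statistics of the probe. -/
lemma le_aliceError {η : unitInterval} (hN : 0 ≤ N) (h1 : (η : ℝ) < 1) :
    (1 - √(1 - (nu η N ^ M * ∑' n, P.p n * ∏ i, Theta η N ^ n i) ^ 2)) / 2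
      ≤ P.aliceError η N := by
  have h := traceNorm_sub_le_of_overlap (P.hasSum_norm_sq_absentVec hN)
    (by simpa only [P.norm_sq_ket] using (isKrausFamily_ampKraus hN h1).hasSum_norm_sq_vec P.ket)
    (P.hasSum_overlap hN h1) (P.hasSum_aliceAbsent hN)
    (hasSum_thermalLoss_rankOne hN h1 P.ket)
  have h2 := ENNReal.toReal_le_of_le_ofReal (by positivity) h
  rw [aliceError, errorProb]
  change _ ≤ 1 / 2 - (traceNorm (P.aliceAbsent N - thermalLoss η N
    (rankOne ℂ P.ket P.ket))).toReal / 4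
  linarith

end Probe

end Alice

/-! ### Willie's photon-number statistics -/

/-- Two distributions that are close in `ℓ¹` have large Bhattacharyya overlap, which is bounded by
weighted sums. -/
lemma sq_one_sub_le_mul_of_tsum_abs_sub_le {ι : Type*} {q₀ q₁ w w' : ι → ℝ} {A B ε : ℝ}
    (hq₀ : ∀ i, 0 ≤ q₀ i) (hq₁ : ∀ i, 0 ≤ q₁ i) (hw : ∀ i, 0 ≤ w i) (hw' : ∀ i, 0 ≤ w' i)
    (h₀ : HasSum q₀ 1) (h₁ : HasSum q₁ 1) (hε : ε ≤ 1 / 2)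
    (hd : ∑' i, |q₀ i - q₁ i| ≤ 4 * ε) (hww : ∀ i, q₀ i = 0 ∨ w' i * w i = 1)
    (hA : HasSum (fun i => q₀ i * w' i) A) (hB : HasSum (fun i => q₁ i * w i) B) :
    (1 - 2 * ε) ^ 2 ≤ A * B := by
  have hA0 : 0 ≤ A := hA.nonneg fun i => mul_nonneg (hq₀ i) (hw' i)
  have hB0 : 0 ≤ B := hB.nonneg fun i => mul_nonneg (hq₁ i) (hw i)
  have habs : Summable fun i => |q₀ i - q₁ i| := (h₀.summable.sub h₁.summable).abs
  have hmin : HasSum (fun i => (q₀ i + q₁ i - |q₀ i - q₁ i|) / 2)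
      ((1 + 1 - ∑' i, |q₀ i - q₁ i|) / 2) := ((h₀.add h₁).sub habs.hasSum).div_const 2
  obtain ⟨hs, hle⟩ := Real.summable_and_inner_le_Lp_mul_Lq_tsum_of_nonneg
    (f := fun i => √(q₀ i * w' i)) (g := fun i => √(q₁ i * w i)) Real.HolderConjugate.two_two
    (fun _ => Real.sqrt_nonneg _) (fun _ => Real.sqrt_nonneg _)
    (hA.summable.congr fun i => by
      rw [Real.rpow_ofNat, Real.sq_sqrt (mul_nonneg (hq₀ i) (hw' i))])
    (hB.summable.congr fun i => by
      rw [Real.rpow_ofNat, Real.sq_sqrt (mul_nonneg (hq₁ i) (hw i))])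
  -- The left side is `min (q₀ i) (q₁ i)`, at most the geometric mean. The weights cancel on the
  -- right, except possibly where `q₀ i = 0`, and there the minimum is `0`.
  have hpt : ∀ i, (q₀ i + q₁ i - |q₀ i - q₁ i|) / 2 ≤ √(q₀ i * w' i) * √(q₁ i * w i) := by
    intro i
    rcases hww i with h | h
    · rw [h, zero_add, zero_sub, abs_neg, abs_of_nonneg (hq₁ i), sub_self, zero_div]
      positivity
    · rw [← Real.sqrt_mul (mul_nonneg (hq₀ i) (hw' i)),
        show q₀ i * w' i * (q₁ i * w i) = q₀ i * q₁ i by linear_combination q₀ i * q₁ i * h]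
      refine Real.le_sqrt_of_sq_le ?_
      rcases abs_cases (q₀ i - q₁ i) with ⟨h1, h2⟩ | ⟨h1, h2⟩ <;> rw [h1] <;>
        nlinarith [hq₀ i, hq₁ i]
  have hAB : 1 - 2 * ε ≤ √A * √B := by
    have h1 := hmin.tsum_eq ▸ (hmin.summable.tsum_le_tsum hpt hs)
    have h2 : ∑' i, √(q₀ i * w' i) * √(q₁ i * w i) ≤ √A * √B := by
      refine hle.trans_eq ?_
      simp only [Real.rpow_ofNat, ← Real.sqrt_eq_rpow]
      rw [← hA.tsum_eq, ← hB.tsum_eq]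
      simp only [Real.sq_sqrt, mul_nonneg, hq₀, hw', hq₁, hw]
    linarith
  calc (1 - 2 * ε) ^ 2 ≤ (√A * √B) ^ 2 := pow_le_pow_left₀ (by linarith) hAB 2
    _ = A * B := by rw [mul_pow, Real.sq_sqrt hA0, Real.sq_sqrt hB0]

lemma summable_mixture {α β : Type*} {p : α → ℝ} {k : α → β → ℝ} {c : α → ℝ}
    (hp : ∀ a, 0 ≤ p a) (hk : ∀ a b, 0 ≤ k a b) (hc : ∀ a, HasSum (k a) (c a))
    (hs : Summable fun a => p a * c a) : Summable fun z : α × β => p z.1 * k z.1 z.2 := by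
  have h1 : ∀ a, HasSum (fun b => p a * k a b) (p a * c a) := fun a => (hc a).mul_left (p a)
  have h0 : 0 ≤ fun z : α × β => p z.1 * k z.1 z.2 := fun z => mul_nonneg (hp _) (hk _ _)
  have h2 : Summable fun a => ∑' b, p a * k a b := by simp_rw [(h1 _).tsum_eq]; exact hs
  exact (summable_prod_of_nonneg h0).mpr ⟨fun a => (h1 a).summable, h2⟩

lemma hasSum_mixture {α β : Type*} {p : α → ℝ} {k : α → β → ℝ} {c : α → ℝ}
    (hp : ∀ a, 0 ≤ p a) (hk : ∀ a b, 0 ≤ k a b) (hc : ∀ a, HasSum (k a) (c a))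
    (hs : Summable fun a => p a * c a) :
    HasSum (fun b => ∑' a, p a * k a b) (∑' a, p a * c a) := by
  have h := summable_mixture hp hk hc hs
  have h1 : ∑' z : α × β, p z.1 * k z.1 z.2 = ∑' a, p a * c a :=
    (h.hasSum.prod_fiberwise fun a => (hc a).mul_left (p a)).tsum_eq.symm
  have h2 := h.prod_symm
  have h3 : ∑' z : β × α, p z.2 * k z.2 z.1 = ∑' a, p a * c a := by
    rw [← h1]; exact (Equiv.prodComm β α).tsum_eq fun z : α × β => p z.1 * k z.1 z.2
  rw [← h3]
  exact h2.hasSum.prod_fiberwise fun b => (h2.prod_factor b).hasSum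

/-! ### Photon statistics after thermal loss -/

section OutputDist

namespace Probe

variable {M : ℕ} {I : Type*} [NormedAddCommGroup I] (P : Probe M I) {κ : unitInterval} {N : ℝ}

/-- The photon-number distribution after thermal loss of the signal. -/
def outputDist (κ : unitInterval) (N : ℝ) (j : Fin M → ℕ) : ℝ :=
  ∑' n, P.p n * prodKernel (lossKernel κ N) n n j j

lemma outputDist_nonneg (hN : 0 ≤ N) (h1 : (κ : ℝ) < 1) (j : Fin M → ℕ) :
    0 ≤ P.outputDist κ N j :=
  tsum_nonneg fun n => mul_nonneg (P.p_nonneg n)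
    ((isKrausFamily_bsKraus hN h1).prodKernel_nonneg n j)

/-- Thermal loss maps the generating function at `x` to that of the input at `T`, up to a prefactor.
Keeping `T` as a parameter serves both normalisation, with `x = T = 1`, and Willie's bound, with `T
= Θ`. -/
lemma hasSum_outputDist_mul_pow (hN : 0 ≤ N) (h1 : (κ : ℝ) < 1) {x : ℝ} (hx0 : 0 ≤ x)
    (hx1 : x ≤ 1) {T : ℝ} (hT : 1 + (x - 1) * κ / (1 + (1 - κ) * N * (1 - x)) = T)
    (hT0 : 0 ≤ T) (hT1 : T ≤ 1) :
    HasSum (fun j => P.outputDist κ N j * ∏ i, x ^ j i)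
      ((1 + (1 - κ) * N * (1 - x))⁻¹ ^ M * ∑' n, P.p n * ∏ i, T ^ n i) := by
  have hk : ∀ n j : Fin M → ℕ, 0 ≤ prodKernel (lossKernel κ N) n n j j * ∏ i, x ^ j i :=
    fun n j => mul_nonneg ((isKrausFamily_bsKraus hN h1).prodKernel_nonneg n j) (by positivity)
  have hc : ∀ n : Fin M → ℕ, HasSum
      (fun j => prodKernel (lossKernel κ N) n n j j * ∏ i, x ^ j i)
      ((1 + (1 - κ) * N * (1 - x))⁻¹ ^ M * ∏ i, T ^ n i) := by
    intro n
    refine hasSum_of_eq (hasSum_pi_prod fun i => hasSum_lossKernel_mul_pow hN h1 hx0 hx1 (n i))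
      (fun j => by rw [prodKernel, Finset.prod_mul_distrib]) ?_
    rw [Finset.prod_mul_distrib, hT]
    simp
  have hs : Summable fun n => P.p n * ((1 + (1 - κ) * N * (1 - x))⁻¹ ^ M * ∏ i, T ^ n i) := by
    have hs' : Summable fun n => P.p n * ∏ i, T ^ n i :=
      P.p_sum.summable.of_nonneg_of_le
        (fun n => mul_nonneg (P.p_nonneg n) (by positivity))
        (fun n => mul_le_of_le_one_right (P.p_nonneg n) (Finset.prod_le_one
          (fun i _ => by positivity) fun i _ => pow_le_one₀ hT0 hT1))
    exact (hs'.mul_left ((1 + (1 - κ) * N * (1 - x))⁻¹ ^ M)).congr fun n => by ring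
  refine hasSum_of_eq (hasSum_mixture P.p_nonneg hk hc hs) (fun j => ?_) ?_
  · rw [outputDist, ← tsum_mul_right]
    exact tsum_congr fun n => by ring
  · rw [← tsum_mul_left]
    exact tsum_congr fun n => by ring

lemma hasSum_outputDist (hN : 0 ≤ N) (h1 : (κ : ℝ) < 1) : HasSum (P.outputDist κ N) 1 := by
  have := P.hasSum_outputDist_mul_pow hN h1 zero_le_one le_rfl (T := 1) (by simp) zero_le_one le_rfl
  simpa [P.p_sum.tsum_eq] using this

end Probe

end OutputDist

/-! ### Willie's states in the number basis -/

section Willie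

open InnerProductSpace

variable {M : ℕ} {I : Type*} [NormedAddCommGroup I] [InnerProductSpace ℂ I]

lemma orthonormal_inMode : Orthonormal ℂ fun j : Fin M → ℕ => inMode j (1 : ℂ) := by
  classical
  rw [orthonormal_iff_ite]
  intro j k
  rw [inner_inMode_left, inMode, lp.singleContinuousLinearMap_apply, lp.single_apply]
  by_cases h : j = k
  · subst h; simp
  · simp [h]

lemma hasSum_thermalState {N : ℝ} (hN : 0 ≤ N) :
    HasSum (fun n : Fin M → ℕ => rankOne ℂ (((√(thermalPMF N n) : ℝ) : ℂ) • inMode n (1 : ℂ))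
      (((√(thermalPMF N n) : ℝ) : ℂ) • inMode n (1 : ℂ))) (thermalState M N) := by
  have hterm : ∀ n : Fin M → ℕ, ((thermalPMF N n : ℝ) : ℂ) •
      (lp.singleContinuousLinearMap ℂ (fun _ : Fin M → ℕ => ℂ) 2 n ∘L (1 : ℂ →L[ℂ] ℂ)
        ∘L lp.evalCLM ℂ (fun _ : Fin M → ℕ => ℂ) 2 n)
      = rankOne ℂ (((√(thermalPMF N n) : ℝ) : ℂ) • inMode n (1 : ℂ))
          (((√(thermalPMF N n) : ℝ) : ℂ) • inMode n (1 : ℂ)) := by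
    intro n
    ext1 φ
    have hpp : ((√(thermalPMF N n) : ℝ) : ℂ) * ((√(thermalPMF N n) : ℝ) : ℂ)
        = (thermalPMF N n : ℂ) := by
      rw [← Complex.ofReal_mul, Real.mul_self_sqrt (thermalPMF_nonneg hN _)]
    have h1 : inMode n (φ n) = φ n • inMode n (1 : ℂ) := by
      rw [inMode, inMode, ← map_smul, smul_eq_mul, mul_one]
    change (thermalPMF N n : ℂ) • inMode n (φ n) = ⟪((√(thermalPMF N n) : ℝ) : ℂ)
      • inMode n (1 : ℂ), φ⟫_ℂ • (((√(thermalPMF N n) : ℝ) : ℂ) • inMode n (1 : ℂ))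
    rw [inner_smul_left, inner_inMode_left, Complex.conj_ofReal, smul_smul, h1, smul_smul, ← hpp,
      RCLike.inner_apply, map_one]
    congr 1
    ring
  rw [thermalState, tensorThermal]
  simp_rw [hterm]
  refine (Summable.of_norm ((hasSum_thermalPMF hN).summable.congr fun n => ?_)).hasSum
  rw [norm_rankOne, norm_smul, norm_inMode, norm_one, mul_one, Complex.norm_real,
    Real.norm_eq_abs, abs_mul_abs_self, Real.mul_self_sqrt (thermalPMF_nonneg hN _)]

lemma inner_thermalState {N : ℝ} (hN : 0 ≤ N) (j : Fin M → ℕ) :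
    ⟪inMode j (1 : ℂ), thermalState M N (inMode j (1 : ℂ))⟫_ℂ = (thermalPMF N j : ℂ) := by
  classical
  have h := inner_apply_single_eq_tsum (hasSum_thermalState (M := M) hN) (1 : ℂ) (1 : ℂ) j j
  rw [inner_inMode_left]
  refine h.unique (hasSum_of_eq (hasSum_single j fun n hn => ?_) (fun n => rfl) ?_)
  · have : inMode n (1 : ℂ) j = 0 := by
      rw [inMode, lp.singleContinuousLinearMap_apply, lp.single_apply, Pi.single_eq_of_ne hn.symm]
    change ⟪(1 : ℂ), ((√(thermalPMF N n) : ℝ) : ℂ) • inMode n (1 : ℂ) j⟫_ℂ * _ = 0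
    rw [this, smul_zero, inner_zero_right, zero_mul]
  · have hpp : ((√(thermalPMF N j) : ℝ) : ℂ) * ((√(thermalPMF N j) : ℝ) : ℂ)
        = (thermalPMF N j : ℂ) := by
      rw [← Complex.ofReal_mul, Real.mul_self_sqrt (thermalPMF_nonneg hN _)]
    change _ = ⟪(1 : ℂ), ((√(thermalPMF N j) : ℝ) : ℂ) • inMode j (1 : ℂ) j⟫_ℂ
      * ⟪((√(thermalPMF N j) : ℝ) : ℂ) • inMode j (1 : ℂ) j, (1 : ℂ)⟫_ℂ
    rw [inMode_apply_self]
    simp [hpp]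

namespace Probe

variable [CompleteSpace I] (P : Probe M I) {κ : unitInterval} {N : ℝ}

/-- The signal state conditioned on the idler being found in a basis vector. -/
def signalVec (b : basisSet I) : Modes M ℂ := braH (onb I b) P.ket

lemma tsum_norm_sq_signalVec_apply (n : Fin M → ℕ) :
    ∑' b, ENNReal.ofReal (‖P.signalVec b n‖ ^ 2) = ENNReal.ofReal (P.p n) := by
  rw [← P.norm_sq_ket_apply, ofReal_norm_sq_eq_tsum _ (onb I)]
  rfl

lemma tsum_norm_sq_signalVec :
    ∑' b, ENNReal.ofReal (‖P.signalVec b‖ ^ 2) = 1 := by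
  have h : ∀ b, ENNReal.ofReal (‖P.signalVec b‖ ^ 2)
      = ∑' n, ENNReal.ofReal (‖P.signalVec b n‖ ^ 2) := fun b =>
    (tsum_ofReal_of_hasSum (fun _ => by positivity) (hasSum_norm_sq_modes _)).symm
  simp_rw [h]
  rw [ENNReal.tsum_comm]
  simp_rw [P.tsum_norm_sq_signalVec_apply]
  rw [tsum_ofReal_of_hasSum P.p_nonneg P.p_sum, ENNReal.ofReal_one]

lemma hasSum_traceAux_density :
    HasSum (fun b => rankOne ℂ (P.signalVec b) (P.signalVec b)) (traceAux P.density) := by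
  have hterm : ∀ b : basisSet I, braH (onb I b) ∘L P.density
      ∘L ContinuousLinearMap.adjoint (braH (onb I b))
      = rankOne ℂ (P.signalVec b) (P.signalVec b) := by
    intro b
    ext1 x
    change braH (onb I b) (⟪P.ket, ContinuousLinearMap.adjoint (braH (onb I b)) x⟫_ℂ • P.ket)
      = ⟪P.signalVec b, x⟫_ℂ • P.signalVec b
    rw [map_smul, ContinuousLinearMap.adjoint_inner_right]
    rfl
  rw [traceAux]
  simp_rw [hterm]
  have hs : HasSum (fun b => ‖P.signalVec b‖ ^ 2) 1 :=
    hasSum_of_tsum_ofReal (fun _ => by positivity) zero_le_one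
      (by rw [P.tsum_norm_sq_signalVec, ENNReal.ofReal_one])
  refine (Summable.of_norm (hs.summable.congr fun b => ?_)).hasSum
  rw [norm_rankOne, sq]

lemma hasSum_norm_sq_willieVec (hN : 0 ≤ N) (h1 : (κ : ℝ) < 1) :
    HasSum (fun z : ((Fin M → ℕ) × (Fin M → ℕ)) × basisSet I =>
      ‖(isKrausFamily_bsKraus hN h1).vec (P.signalVec z.2) z.1‖ ^ 2) 1 := by
  refine hasSum_of_tsum_ofReal (fun _ => by positivity) zero_le_one ?_
  rw [ENNReal.tsum_prod (f := fun e b =>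
    ENNReal.ofReal (‖(isKrausFamily_bsKraus hN h1).vec (P.signalVec b) e‖ ^ 2)), ENNReal.tsum_comm]
  simp_rw [IsKrausFamily.tsum_norm_sq_vec]
  rw [P.tsum_norm_sq_signalVec, ENNReal.ofReal_one]

lemma hasSum_thermalLoss_traceAux (hN : 0 ≤ N) (h1 : (κ : ℝ) < 1) :
    HasSum (fun z : ((Fin M → ℕ) × (Fin M → ℕ)) × basisSet I =>
      rankOne ℂ ((isKrausFamily_bsKraus hN h1).vec (P.signalVec z.2) z.1)
        ((isKrausFamily_bsKraus hN h1).vec (P.signalVec z.2) z.1))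
      (thermalLoss κ N (traceAux P.density)) := by
  have hs : Summable fun z : ((Fin M → ℕ) × (Fin M → ℕ)) × basisSet I =>
      rankOne ℂ ((isKrausFamily_bsKraus hN h1).vec (P.signalVec z.2) z.1)
        ((isKrausFamily_bsKraus hN h1).vec (P.signalVec z.2) z.1) := by
    refine Summable.of_norm ((P.hasSum_norm_sq_willieVec hN h1).summable.congr fun z => ?_)
    rw [norm_rankOne, sq]
  have hfib : ∀ e : (Fin M → ℕ) × (Fin M → ℕ), HasSum (fun b : basisSet I =>
      rankOne ℂ ((isKrausFamily_bsKraus hN h1).vec (P.signalVec b) e)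
        ((isKrausFamily_bsKraus hN h1).vec (P.signalVec b) e))
      (((thermalPMF N e.1 : ℝ) : ℂ) • (kraus κ e.1 e.2 ∘L traceAux P.density
        ∘L ContinuousLinearMap.adjoint (kraus κ e.1 e.2))) := by
    intro e
    set L : (Modes M ℂ →L[ℂ] Modes M ℂ) →L[ℂ] (Modes M ℂ →L[ℂ] Modes M ℂ) :=
      (ContinuousLinearMap.compL ℂ (Modes M ℂ) (Modes M ℂ) (Modes M ℂ) (kraus κ e.1 e.2)) ∘L
      ((ContinuousLinearMap.compL ℂ (Modes M ℂ) (Modes M ℂ) (Modes M ℂ)).flip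
        (ContinuousLinearMap.adjoint (kraus κ e.1 e.2))) with hL
    exact hasSum_of_eq ((P.hasSum_traceAux_density.mapL L).const_smul
      ((thermalPMF N e.1 : ℝ) : ℂ)) (fun b => (thermalLoss_term_eq hN h1 _ e).symm) rfl
  have := hs.hasSum.prod_fiberwise hfib
  rw [thermalLoss, this.tsum_eq]
  exact hs.hasSum

/-- Each Kraus operator shifts the photon number by a fixed amount, so coherences of the signal do
not reach the diagonal. Parseval over the idler basis reduces the remaining weights to `P.p`. -/
lemma inner_thermalLoss_traceAux (hN : 0 ≤ N) (h1 : (κ : ℝ) < 1) (j : Fin M → ℕ) :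
    ⟪inMode j (1 : ℂ), thermalLoss κ N (traceAux P.density) (inMode j (1 : ℂ))⟫_ℂ
      = (P.outputDist κ N j : ℂ) := by
  have h := inner_apply_single_eq_tsum (P.hasSum_thermalLoss_traceAux hN h1) (1 : ℂ) (1 : ℂ) j j
  rw [inner_inMode_left]
  have hK := (isKrausFamily_bsKraus hN h1).prodKernel_nonneg (M := M)
  have hsn : Summable fun n => P.p n * prodKernel (lossKernel κ N) n n j j :=
    (summable_mixture P.p_nonneg hK (fun n => (isKrausFamily_bsKraus hN h1).hasSum_prodKernel n)
      (by simpa using P.p_sum.summable)).prod_symm.prod_factor j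
  have hr : HasSum (fun z : ((Fin M → ℕ) × (Fin M → ℕ)) × basisSet I =>
      ‖(isKrausFamily_bsKraus hN h1).vec (P.signalVec z.2) z.1 j‖ ^ 2) (P.outputDist κ N j) := by
    refine hasSum_of_tsum_ofReal (fun _ => by positivity) (P.outputDist_nonneg hN h1 j) ?_
    rw [ENNReal.tsum_prod (f := fun e b =>
      ENNReal.ofReal (‖(isKrausFamily_bsKraus hN h1).vec (P.signalVec b) e j‖ ^ 2)),
      ENNReal.tsum_comm]
    simp_rw [IsKrausFamily.vec_apply, (isKrausFamily_bsKraus hN h1).tsum_norm_sq_multiKrausFun]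
    rw [ENNReal.tsum_comm]
    simp_rw [ENNReal.tsum_mul_left, P.tsum_norm_sq_signalVec_apply]
    rw [outputDist, ENNReal.ofReal_tsum_of_nonneg (fun n => mul_nonneg (P.p_nonneg n) (hK n j)) hsn]
    exact tsum_congr fun n => by rw [mul_comm, ENNReal.ofReal_mul (P.p_nonneg n)]
  refine h.unique (hasSum_of_eq (Complex.hasSum_ofReal.mpr hr) (fun z => ?_) rfl)
  simp only [RCLike.inner_apply, map_one, mul_one, one_mul]
  rw [Complex.mul_conj, Complex.normSq_eq_norm_sq]

/-- Covertness bounds the `ℓ¹` distance of Willie's photon-number distributions. -/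
lemma IsCovert.tsum_abs_sub_le {P : Probe M I} {η : unitInterval} {ε : ℝ}
    (h : P.IsCovert η N ε) (hN : 0 ≤ N) (h0 : 0 < (η : ℝ)) :
    ∑' j, |thermalPMF N j - P.outputDist (unitInterval.symm η) N j| ≤ 4 * ε := by
  have h1 : ((unitInterval.symm η : unitInterval) : ℝ) < 1 := by
    rw [unitInterval.coe_symm_eq]; linarith
  set u : (Fin M → ℕ) → Modes M ℂ := fun n => ((√(thermalPMF N n) : ℝ) : ℂ) • inMode n (1 : ℂ)
    with hu
  set v : ((Fin M → ℕ) × (Fin M → ℕ)) × basisSet I → Modes M ℂ := fun z =>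
    (isKrausFamily_bsKraus hN h1).vec (P.signalVec z.2) z.1 with hv
  have hρ : HasSum (fun n => rankOne ℂ (u n) (u n)) (thermalState M N) := hasSum_thermalState hN
  have hσ : HasSum (fun z => rankOne ℂ (v z) (v z)) (P.willieProbed η N) :=
    P.hasSum_thermalLoss_traceAux hN h1
  have hX : IsSelfAdjoint (thermalState M N - P.willieProbed η N) :=
    (isSelfAdjoint_of_hasSum (fun e => (isPositive_rankOne_self (u e)).isSelfAdjoint) hρ).sub
      (isSelfAdjoint_of_hasSum (fun e => (isPositive_rankOne_self (v e)).isSelfAdjoint) hσ)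
  have hun : HasSum (fun n => ‖u n‖ * ‖u n‖) 1 := by
    refine hasSum_of_eq (hasSum_thermalPMF hN) (fun n => ?_) rfl
    rw [hu, norm_smul, norm_inMode, norm_one, mul_one, Complex.norm_real,
      Real.norm_eq_abs, abs_mul_abs_self, Real.mul_self_sqrt (thermalPMF_nonneg hN _)]
  have hvn : HasSum (fun z => ‖-v z‖ * ‖v z‖) 1 :=
    hasSum_of_eq (P.hasSum_norm_sq_willieVec hN h1) (fun z => by rw [norm_neg, sq]) rfl
  -- Finiteness matters: `toReal` sends `⊤` to `0`, in which case the covertness hypothesis would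
  -- carry no bound.
  have hfin : traceNorm (thermalState M N - P.willieProbed η N) ≠ ⊤ := by
    have hs : HasSum (fun z => ‖Sum.elim u (fun z => -v z) z‖ * ‖Sum.elim u v z‖) (1 + 1) :=
      HasSum.sum hun hvn
    have hr : HasSum (fun z => rankOne ℂ (Sum.elim u (fun z => -v z) z) (Sum.elim u v z))
        (thermalState M N + -P.willieProbed η N) :=
      HasSum.sum hρ (hasSum_of_eq hσ.neg (fun z => by simp) rfl)
    rw [← sub_eq_add_neg] at hr
    exact ne_top_of_le_ne_top ENNReal.ofReal_ne_top (traceNorm_le_tsum hX hs.summable hr)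
  have hle := tsum_norm_inner_le_traceNorm (orthonormal_inMode (M := M)) hX
  have hdiag : ∀ j : Fin M → ℕ, ‖⟪inMode j (1 : ℂ), (thermalState M N - P.willieProbed η N)
      (inMode j (1 : ℂ))⟫_ℂ‖ = |thermalPMF N j - P.outputDist (unitInterval.symm η) N j| := by
    intro j
    rw [sub_apply, inner_sub_right, inner_thermalState hN, willieProbed,
      P.inner_thermalLoss_traceAux hN h1, ← Complex.ofReal_sub, Complex.norm_real,
      Real.norm_eq_abs]
  simp_rw [hdiag] at hle
  have hsum : Summable fun j : Fin M → ℕ =>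
      |thermalPMF N j - P.outputDist (unitInterval.symm η) N j| :=
    ((hasSum_thermalPMF hN).summable.sub (P.hasSum_outputDist hN h1).summable).abs
  rw [← ENNReal.ofReal_tsum_of_nonneg (fun _ => abs_nonneg _) hsum] at hle
  have h2 := (ENNReal.ofReal_le_iff_le_toReal hfin).mp hle
  rw [IsCovert, willieError, errorProb] at h
  linarith

end Probe

end Willie

/-! ### The constants of the bound -/

section Constants

variable {η : unitInterval} {N : ℝ}

/-- This is `(1 - Θ²) G = G - (1 - η)(N + 1) = η`, factored to give control of `1 - Θ`. -/
lemma one_sub_Theta_mul (hN : 0 ≤ N) (η : unitInterval) :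
    (1 - Theta η N) * ((1 + Theta η N) * gain η N) = η := by
  have hsq : Theta η N ^ 2 = lossParam η N := by
    rw [Theta_eq_sqrt_lossParam hN, Real.sq_sqrt (lossParam_nonneg hN η)]
  have hw : lossParam η N * gain η N = (1 - η) * (N + 1) :=
    div_mul_cancel₀ _ (gain_pos hN η).ne'
  have hG : gain η N = 1 + (1 - η) * N := rfl
  linear_combination (-gain η N) * hsq - hw + hG

/-- In fact `Θ² ≥ 1 - η ≥ 3/5`; `7/10` is a convenient rational below `√(3/5)` that still suffices
for the convergence condition. -/
lemma seven_tenths_le_Theta (hN : 0 ≤ N) (hη : (η : ℝ) ≤ 2 / 5) : 7 / 10 ≤ Theta η N := by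
  rw [Theta_eq_sqrt_lossParam hN]
  refine Real.le_sqrt_of_sq_le ?_
  rw [lossParam, le_div_iff₀ (gain_pos hN η), gain]
  nlinarith [mul_nonneg hN (sub_nonneg.mpr η.2.2)]

/-- The convergence condition holds for every background noise when `η ≤ 2 / 5`. -/
lemma convergenceCondition_of_le (hN : 0 ≤ N) (hη : (η : ℝ) ≤ 2 / 5) :
    ConvergenceCondition η N := by
  have hη0 : 0 ≤ (η : ℝ) := η.2.1
  have hkey := one_sub_Theta_mul hN η
  have hΘ := seven_tenths_le_Theta hN hη
  have hΘ1 := Theta_le_one hN η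
  have hG : gain η N = 1 + (1 - η) * N := rfl
  have hGpos := gain_pos hN η
  set Θ := Theta η N with hΘdef
  -- After clearing a positive denominator, this is the lower bound `N / (N + 1) ≤ x`. It reduces to
  -- `η ≤ 1.7 (1 - η)` and `η (1 + η) ≤ 1.7 (1 - η)²`, where `1.7` is the lower bound for `1 + Θ`.
  have hmain : (1 - Θ) * (N + 1 + η * N) ≤ 1 - η := by
    have hden : 0 < (1 + Θ) * gain η N := by positivity
    have h1 : 1 - Θ = η / ((1 + Θ) * gain η N) := by
      rw [eq_div_iff hden.ne']; exact hkey
    rw [h1, div_mul_eq_mul_div, div_le_iff₀ hden]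
    have h2 : 17 / 10 * gain η N ≤ (1 + Θ) * gain η N :=
      mul_le_mul_of_nonneg_right (by linarith) hGpos.le
    have h3 : (η : ℝ) * (N + 1 + η * N) ≤ (1 - η) * (17 / 10 * gain η N) := by
      rw [hG]
      have a1 : (η : ℝ) ≤ (1 - η) * (17 / 10) := by linarith
      have a2 : (η : ℝ) * (1 + η) ≤ (1 - η) * (17 / 10) * (1 - η) := by nlinarith
      nlinarith [mul_le_mul_of_nonneg_right a2 hN]
    exact h3.trans (mul_le_mul_of_nonneg_left h2 (by linarith))
  have hd : xDenom η N = 1 - η * (1 + N * (1 - Θ)) := rfl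
  have hge : (1 - Θ) * (N + 1) ≤ xDenom η N := by rw [hd]; linarith
  have hpos : 0 < xDenom η N := by
    rw [hd]
    have h0 : 0 ≤ 1 - Θ := by linarith
    have h2 : N * (1 - Θ) ≤ 1 - η := by nlinarith [mul_nonneg hη0 hN]
    nlinarith [mul_nonneg hN h0]
  have hN1 : 0 < N + 1 := by positivity
  refine ⟨hpos.ne', ?_, ?_⟩
  · have : (1 - Θ) / xDenom η N ≤ 1 / (N + 1) := by
      rw [div_le_div_iff₀ hpos hN1]; linarith
    have e : N / (N + 1) = 1 - 1 / (N + 1) := by field_simp; ring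
    rw [xVal, e]
    linarith
  · rw [xVal]
    have : 0 ≤ (1 - Θ) / xDenom η N := div_nonneg (by linarith) hpos.le
    linarith

/-- The defining property of `xVal`. -/
lemma Theta_eq_of_xVal (h1 : (η : ℝ) < 1) (hd : xDenom η N ≠ 0) :
    1 + (xVal η N - 1) * (1 - η) / (1 + η * N * (1 - xVal η N)) = Theta η N := by
  have hη : 1 - (η : ℝ) ≠ 0 := by linarith
  -- Since `1 - x = (1 - Θ) / xDenom`, the numerator is `xDenom + η N (1 - Θ) = 1 - η`.
  have e : 1 + η * N * (1 - xVal η N) = (1 - η) / xDenom η N := by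
    rw [xVal]
    field_simp
    rw [xDenom]
    ring
  rw [e, xVal]
  field_simp
  ring

lemma nu_nonneg (hN : 0 ≤ N) (η : unitInterval) : 0 ≤ nu η N :=
  (hasSum_nu (η := η) hN).nonneg fun _ => by positivity

lemma eq_zero_of_div_le (hN : 0 ≤ N) {x : ℝ} (hx : N / (N + 1) ≤ x) : x = 0 → N = 0 := by
  intro hx'
  rw [hx'] at hx
  by_contra hne
  have hpos : 0 < N := lt_of_le_of_ne hN (Ne.symm hne)
  have : 0 < N / (N + 1) := by positivity
  linarith

lemma add_one_sub_div_nonneg (hN : 0 ≤ N) {x : ℝ} (hx : N / (N + 1) ≤ x) :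
    0 ≤ N + 1 - N / x := by
  have hx0 : 0 ≤ x := le_trans (by positivity) hx
  rcases hx0.eq_or_lt with h | h
  · rw [eq_zero_of_div_le hN hx h.symm]; simp
  · rw [div_le_iff₀ (by positivity)] at hx
    have : N / x ≤ N + 1 := by rw [div_le_iff₀ h]; linarith
    linarith

lemma fVal_nonneg (hN : 0 ≤ N) (hcc : ConvergenceCondition η N) : 0 ≤ fVal η N := by
  obtain ⟨-, hxl, hx1⟩ := hcc
  have := mul_nonneg (mul_nonneg η.2.1 hN) (sub_nonneg.mpr hx1)
  exact mul_nonneg (mul_nonneg (nu_nonneg hN η) (add_one_sub_div_nonneg hN hxl)) (by linarith)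

/-- Positivity of `N + 1 - N / x` says that the geometric ratio `N / ((N + 1) x)` is below one. At
`x = 0` the conventions `x⁻¹ = 0` and `N / x = 0` leave only the vacuum term. -/
lemma hasSum_thermalProb_mul_inv_pow (hN : 0 ≤ N) {x : ℝ} (hx0 : 0 ≤ x)
    (hx : 0 < N + 1 - N / x) :
    HasSum (fun j : ℕ => thermalProb N j * x⁻¹ ^ j) (N + 1 - N / x)⁻¹ := by
  have hN1 : 0 < N + 1 := by positivity
  have e : N / (N + 1) * x⁻¹ = (N / x) / (N + 1) := by
    rw [div_mul_eq_mul_div, div_eq_mul_inv N x]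
  have hlt : N / (N + 1) * x⁻¹ < 1 := by
    rw [e, div_lt_one hN1]; linarith
  refine hasSum_of_eq ((hasSum_geometric_of_lt_one (by positivity) hlt).mul_left (N + 1)⁻¹)
    (fun j => by rw [thermalProb_eq hN, mul_pow]; ring) ?_
  rw [← mul_inv, e, mul_sub, mul_one, mul_div_cancel₀ _ hN1.ne']

end Constants

/-! ### From covertness to a lower bound on the overlap -/

section Bound

variable {M : ℕ} {I : Type*} [NormedAddCommGroup I] [InnerProductSpace ℂ I] [CompleteSpace I]

/-- The weights `x⁻¹ ^ j` and `x ^ j` fail to be inverse only if `x = 0` and `j ≠ 0`; then `N = 0`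
and the thermal state is the vacuum. -/
lemma thermalPMF_eq_zero_or_inv_pow_mul_pow_eq_one {N x : ℝ} (hNx : x = 0 → N = 0)
    (j : Fin M → ℕ) : thermalPMF N j = 0 ∨ (∏ i, x⁻¹ ^ j i) * ∏ i, x ^ j i = 1 := by
  by_cases hx : x = 0
  · by_cases hj : j = 0
    · right; simp [hj]
    · left
      obtain ⟨i, hi⟩ := Function.ne_iff.mp hj
      refine Finset.prod_eq_zero (Finset.mem_univ i) ?_
      rw [hNx hx, zero_pow (by simpa using hi), zero_div]
  · right
    rw [← Finset.prod_mul_distrib]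
    refine Finset.prod_eq_one fun i _ => ?_
    rw [← mul_pow, inv_mul_cancel₀ hx, one_pow]

/-- Covertness forces the photon-number statistics of the probe to concentrate near vacuum. -/
lemma Probe.IsCovert.sq_mul_fVal_pow_le {P : Probe M I} {η : unitInterval} {N ε : ℝ}
    (h : P.IsCovert η N ε) (hN : 0 ≤ N) (h0 : 0 < (η : ℝ)) (h1 : (η : ℝ) < 1)
    (hcc : ConvergenceCondition η N) (hε0 : 0 ≤ ε) (hε : ε ≤ 1 / 2) :
    (1 - 2 * ε) ^ 2 * fVal η N ^ M
      ≤ nu η N ^ M * ∑' n, P.p n * ∏ i, Theta η N ^ n i := by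
  obtain ⟨hd, hxl, hx1⟩ := hcc
  have hΘ := Theta_eq_of_xVal h1 hd
  have hν := nu_nonneg hN η
  set x := xVal η N with hx
  have hx0 : 0 ≤ x := le_trans (by positivity) hxl
  have hNx := eq_zero_of_div_le hN hxl
  have hnonneg := add_one_sub_div_nonneg hN hxl
  have hD : 0 < 1 + η * N * (1 - x) := by
    have := mul_nonneg (mul_nonneg h0.le hN) (sub_nonneg.mpr hx1)
    linarith
  have hf : fVal η N = nu η N * ((N + 1 - N / x) * (1 + η * N * (1 - x))) := by
    rw [fVal, ← hx]; ring
  -- On the boundary `N + 1 = N / x` the thermal series diverges, but `f = 0` and the claim is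
  -- trivial for `M > 0`. For `M = 0` both powers are `1` and only `(1 - 2ε)² ≤ 1` is needed.
  rcases hnonneg.eq_or_lt with hz | hpos
  · rcases Nat.eq_zero_or_pos M with hM | hM
    · subst hM
      simp only [pow_zero, mul_one, Finset.univ_eq_empty, Finset.prod_empty,
        P.p_sum.tsum_eq]
      nlinarith
    · rw [hf, ← hz, zero_mul, mul_zero, zero_pow hM.ne', mul_zero]
      exact mul_nonneg (pow_nonneg hν _) (tsum_nonneg fun n => mul_nonneg (P.p_nonneg n)
        (Finset.prod_nonneg fun i _ => pow_nonneg (Theta_nonneg _ _) _))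
  · have hsymm : ((unitInterval.symm η : unitInterval) : ℝ) = 1 - η := unitInterval.coe_symm_eq η
    have hlt : ((unitInterval.symm η : unitInterval) : ℝ) < 1 := by rw [hsymm]; linarith
    -- Willie's transmittance is `1 - η`, so the noise coefficient is `1 - (1 - η) = η`, and the
    -- defining equation of `x` makes the new argument exactly `Θ`.
    have hB := P.hasSum_outputDist_mul_pow hN hlt hx0 hx1 (T := Theta η N)
      (by rw [hsymm, sub_sub_cancel]; exact hΘ) (Theta_nonneg _ _) (Theta_le_one hN η)
    rw [hsymm, sub_sub_cancel] at hB
    have hA : HasSum (fun j : Fin M → ℕ => thermalPMF N j * ∏ i, x⁻¹ ^ j i)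
        ((N + 1 - N / x)⁻¹ ^ M) :=
      hasSum_of_eq (hasSum_pi_prod fun _ : Fin M => hasSum_thermalProb_mul_inv_pow hN hx0 hpos)
        (fun j => by rw [thermalPMF_eq_prod, Finset.prod_mul_distrib]) (by simp)
    have hmain := sq_one_sub_le_mul_of_tsum_abs_sub_le (q₀ := thermalPMF (M := M) N)
      (q₁ := P.outputDist (unitInterval.symm η) N) (w := fun j => ∏ i, x ^ j i)
      (w' := fun j => ∏ i, x⁻¹ ^ j i) (thermalPMF_nonneg hN) (P.outputDist_nonneg hN hlt)
      (fun j => by positivity) (fun j => by positivity)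
      (hasSum_thermalPMF hN) (P.hasSum_outputDist hN hlt) hε (h.tsum_abs_sub_le hN h0)
      (thermalPMF_eq_zero_or_inv_pow_mul_pow_eq_one hNx) hA hB
    rw [hf, mul_pow, mul_left_comm]
    refine mul_le_mul_of_nonneg_left ?_ (pow_nonneg hν M)
    have hpp : 0 < ((N + 1 - N / x) * (1 + η * N * (1 - x))) ^ M := by positivity
    rw [← le_div_iff₀ hpp]
    refine hmain.trans_eq ?_
    rw [mul_pow, inv_pow, inv_pow]
    field_simp

end Bound

end CovertQI

end

theorem mainTheorem1 (η : unitInterval) (hη0 : 0 < (η : ℝ)) (hη1 : (η : ℝ) < 1)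
    (N_B : ℝ) (hN : 0 ≤ N_B) :
    ((η : ℝ) ≤ 2 / 5 → CovertQI.ConvergenceCondition η N_B) ∧
    (CovertQI.ConvergenceCondition η N_B →
      ∀ (M : ℕ) (I : Type*) [NormedAddCommGroup I] [InnerProductSpace ℂ I] [CompleteSpace I]
        (P : CovertQI.Probe M I) (ε : ℝ), 0 ≤ ε → ε ≤ 1 / 2 → P.IsCovert η N_B ε →
        (1 - √(1 - (1 - 2 * ε) ^ 4 * CovertQI.fVal η N_B ^ (2 * M))) / 2
          ≤ P.aliceError η N_B) := by
  refine ⟨CovertQI.convergenceCondition_of_le hN, fun hcc M I _ _ _ P ε hε0 hε hcov => ?_⟩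
  refine le_trans ?_ (P.le_aliceError hN hη1)
  have hle := hcov.sq_mul_fVal_pow_le hN hη0 hη1 hcc hε0 hε
  -- Nonnegativity of the lower bound for the overlap is what allows both sides to be squared.
  have h0 : 0 ≤ (1 - 2 * ε) ^ 2 * CovertQI.fVal η N_B ^ M := by
    refine mul_nonneg (sq_nonneg _) (pow_nonneg ?_ M)
    exact CovertQI.fVal_nonneg hN hcc
  have hsq := pow_le_pow_left₀ h0 hle 2
  have e : ((1 - 2 * ε) ^ 2 * CovertQI.fVal η N_B ^ M) ^ 2
      = (1 - 2 * ε) ^ 4 * CovertQI.fVal η N_B ^ (2 * M) := by ring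
  rw [e] at hsq
  have := Real.sqrt_le_sqrt (sub_le_sub_left hsq 1)
  linarith
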